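/- Let $F$ be a probability distribution on $[0,\infty)$ with $\int x^4\,dF(x)<\infty$, and let $X_1,X_2,\dots$ be i.i.d. random variables with law $F$. Put $\mu=E[X_1]$, assumed positive, $\sigma^2=\mathrm{Var}(X_1)$, $\Delta=E|X_1-X_2|$, $\tau=E(X_1|X_1-X_2|)$, $\sigma_1^2=\mathrm{Var}\bigl(E[\,|X_1-X_2|\,\big|\,X_1]\bigr)$, let $G_F=\Delta/(2\mu)$ be the Gini index, and assume that $$\xi^2=\frac{\Delta^2\sigma^2}{4\mu^4}-\frac{\Delta\tau}{\mu^3}+\frac{\Delta^2}{\mu^2}+\frac{\sigma_1^2}{\mu^2}>0 .$$ For $n\ge 4$ let $\bar X_n$ and $S_n^2$ be the sample mean and the (unbiased) sample variance of $X_1,\dots,X_n$, and let $$\widehat\Delta_n=\binom n2^{-1}\sum_{1\le i<j\le n}|X_i-X_j|,\qquad \widehat G_n=\frac{\widehat\Delta_n}{2\bar X_n},\qquad \widehat\tau_n=\frac{2}{n(n-1)}\sum_{1\le i<j\le n}\tfrac12(X_i+X_j)|X_i-X_j| .$$ For $1\le j\le n$ let $\widehat\Delta_n^{(j)}$ be Gini's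 mean difference computed from the $n-1$ observations other than $X_j$ (normalised by $\binom{n-1}{2}^{-1}$), let $W_{jn}=n\widehat\Delta_n-(n-2)\widehat\Delta_n^{(j)}$, $\overline W_n=n^{-1}\sum_{j=1}^n W_{jn}$, $s_{wn}^2=(n-1)^{-1}\sum_{j=1}^n(W_{jn}-\overline W_n)^2$, and $$V_n^2=\frac{\widehat\Delta_n^2S_n^2}{4\bar X_n^4}-\frac{\widehat\Delta_n}{\bar X_n^3}\widehat\tau_n+\frac{\widehat\Delta_n^2}{\bar X_n^2}+\frac{s_{wn}^2}{4\bar X_n^2}$$ whenever $\bar X_n\ne 0$. Let $0<\alpha<1$ and let $z_{\alpha/2}$ be the upper $\alpha/2$ quantile of the standard normal distribution. For $d>0$ let $m=\max\{4,z_{\alpha/2}/d\}$ and let $N_d$ be the smallest integer $n\ge m$ such that $\bar X_n\neq0$ (so that $V_n^2$ is defined) and $$n\ge\left(\frac{z_{\alpha/2}}{d}\right)^2\left(V_n^2+\frac1n\right),$$ with $N_d=\infty$ if there is no such $n$. Then $N_d<\infty$ almost surely for every $d>0$, and $$P\bigl(\widehat G_{N_d}-d<G_F<\widehat G_{N_d}+d\bigr)\to1-\alpha\qquad\text{as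 } d\downarrow0 .$$ -/

import Mathlib

open MeasureTheory ProbabilityTheory Filter Topology

namespace GiniSeq

noncomputable section

/-! ### Population quantities of a parent distribution `F` on the real line -/

/-- The population mean `μ = E X`. -/
def popMean (F : Measure ℝ) : ℝ := ∫ x, x ∂F

/-- Gini's mean difference `Δ = E|X₁ - X₂|`, with `X₁, X₂` independent of law `F`. -/
def popMeanDiff (F : Measure ℝ) : ℝ := ∫ p : ℝ × ℝ, |p.1 - p.2| ∂(F.prod F)

/-- The population Gini index `G_F = Δ / (2 μ)`. -/
def giniIndex (F : Measure ℝ) : ℝ := popMeanDiff F / (2 * popMean F)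

/-- `τ = E(X₁ |X₁ - X₂|)`. -/
def popTau (F : Measure ℝ) : ℝ := ∫ p : ℝ × ℝ, p.1 * |p.1 - p.2| ∂(F.prod F)

/-- The population variance `σ² = Var X`. -/
def popVar (F : Measure ℝ) : ℝ := variance (fun x : ℝ => x) F

/-- `σ₁² = Var (g X₁)`, where `g x = E|x - X₂| = E(|X₁ - X₂| given X₁ = x)`. -/
def projVar (F : Measure ℝ) : ℝ := variance (fun x : ℝ => ∫ y, |x - y| ∂F) F

/-- The asymptotic variance `ξ²` of the sample Gini index. -/
def asympVar (F : Measure ℝ) : ℝ :=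
  popMeanDiff F ^ 2 / (4 * popMean F ^ 4) * popVar F
    - popMeanDiff F * popTau F / popMean F ^ 3
    + popMeanDiff F ^ 2 / popMean F ^ 2
    + projVar F / popMean F ^ 2

/-! ### Sample quantities

The first `n` terms of `x : ℕ → ℝ`, that is `x 0, …, x (n - 1)`, are the observations
`X₁, …, Xₙ`. -/

/-- The index pairs `i₁ < i₂` of a sample of size `n`. -/
def pairs (n : ℕ) : Finset (ℕ × ℕ) :=
  (Finset.range n ×ˢ Finset.range n).filter (fun p => p.1 < p.2)

/-- The sample mean. -/
def sampleMean (x : ℕ → ℝ) (n : ℕ) : ℝ := (∑ i ∈ Finset.range n, x i) / n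

/-- The sample Gini mean difference. -/
def sampleMeanDiff (x : ℕ → ℝ) (n : ℕ) : ℝ :=
  (∑ p ∈ pairs n, |x p.1 - x p.2|) / (n.choose 2 : ℝ)

/-- The sample Gini index. -/
def sampleGini (x : ℕ → ℝ) (n : ℕ) : ℝ := sampleMeanDiff x n / (2 * sampleMean x n)

/-- The sample Gini mean difference of the `n - 1` observations other than the `j`-th. -/
def deletedMeanDiff (x : ℕ → ℝ) (n j : ℕ) : ℝ :=
  (∑ p ∈ (pairs n).filter (fun p => p.1 ≠ j ∧ p.2 ≠ j), |x p.1 - x p.2|)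
    / ((n - 1).choose 2 : ℝ)

/-- The quantity `W_{jn}`, a multiple of a difference of mean differences. -/
def pseudoValue (x : ℕ → ℝ) (n j : ℕ) : ℝ :=
  (n : ℝ) * sampleMeanDiff x n - ((n : ℝ) - 2) * deletedMeanDiff x n j

/-- The estimator `s²_{wn}` of `4 σ₁²`: the sample variance of `W_{1n}, …, W_{nn}`. -/
def pseudoVar (x : ℕ → ℝ) (n : ℕ) : ℝ :=
  (∑ j ∈ Finset.range n,
    (pseudoValue x n j - (∑ i ∈ Finset.range n, pseudoValue x n i) / n) ^ 2) / ((n : ℝ) - 1)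

/-- The estimator of `τ`. -/
def sampleTau (x : ℕ → ℝ) (n : ℕ) : ℝ :=
  2 / ((n : ℝ) * ((n : ℝ) - 1)) *
    ∑ p ∈ pairs n, 1 / 2 * (x p.1 + x p.2) * |x p.1 - x p.2|

/-- The sample variance. -/
def sampleVar (x : ℕ → ℝ) (n : ℕ) : ℝ :=
  (∑ i ∈ Finset.range n, (x i - sampleMean x n) ^ 2) / ((n : ℝ) - 1)

/-- The estimator `Vₙ²` of `ξ²` (meaningful when the sample mean is nonzero). -/
def varEst (x : ℕ → ℝ) (n : ℕ) : ℝ :=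
  sampleMeanDiff x n ^ 2 * sampleVar x n / (4 * sampleMean x n ^ 4)
    - sampleMeanDiff x n / sampleMean x n ^ 3 * sampleTau x n
    + sampleMeanDiff x n ^ 2 / sampleMean x n ^ 2
    + pseudoVar x n / (4 * sampleMean x n ^ 2)

/-! ### The sequential procedure -/

/-- The upper `p`-quantile `z_p` of the standard normal law. -/
def upperQuantile (p : ℝ) : ℝ := sInf {z : ℝ | 1 - p ≤ cdf (gaussianReal 0 1) z}

/-- The sample sizes at which the procedure may stop: `n ≥ m = max {4, z_{α/2} / d}`,
the estimator `Vₙ²` is defined (nonzero sample mean), and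
`n ≥ (z_{α/2} / d)² (Vₙ² + 1 / n)`. -/
def stopSet (α d : ℝ) (x : ℕ → ℝ) : Set ℕ :=
  {n : ℕ | max 4 (upperQuantile (α / 2) / d) ≤ (n : ℝ) ∧ sampleMean x n ≠ 0 ∧
    (upperQuantile (α / 2) / d) ^ 2 * (varEst x n + (n : ℝ)⁻¹) ≤ (n : ℝ)}

/-- The stopping time `N_d`: the smallest element of `stopSet α d x`, and `⊤` when there
is none. -/
def stopTime (α d : ℝ) (x : ℕ → ℝ) : ℕ∞ := ⨅ n ∈ stopSet α d x, (n : ℕ∞)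

end

end GiniSeq

/-!
The proof follows the pattern of Chow and Robbins, with Anscombe's theorem for the random index.
Write `g t = E|t - X|` (`meanDist`), `G` for the Gini index, `z` for the upper `α / 2`
quantile of the standard normal law, and `r = z / d`.

*Consistency of the variance estimator.* Every term of `varEst` is a function of empirical means
of `x`, `x ^ 2`, and of `gₙ (x j)`, `x j * gₙ (x j)` and `gₙ (x j) ^ 2`, where `gₙ` (`empDist`) is
the mean distance to the sample; in particular the pseudo-value `W_{jn}` is a multiple of `gₙ (x j)`.
Almost surely `gₙ → g` uniformly on the half-line (`eventually_abs_empDist_sub_le`), so `gₙ` may be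
replaced by `g` and the strong law of large numbers applies. No strong law for U-statistics is
needed. Hence `Vₙ² → ξ²` almost surely (`IsTypical.tendsto_varEst`), the procedure stops, and
`N_d` is close to `r² ξ²` for small `d` (`eventually_stopTime_close`).

*Linearisation.* With `ψ = 2 μ (g - Δ) - Δ (· - μ)` (`linKernel`) one has exactly
`2 μ X̄ₙ n (Ĝₙ - G) = ∑ ψ (X i) + μ Eₙ`, where `Eₙ` (`meanDiffRem`) is `2 / (n - 1)` times the sum
over pairs of the completely degenerate kernel `|x - y| - g x - g y + Δ`. The variance of `ψ (X 0)` is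
`4 μ⁴ ξ²`.

*Random index.* The partial sums of `ψ (X i)` and the sums of the degenerate kernel are both
square-integrable martingales, and one Kolmogorov inequality
(`measureReal_exists_le_abs_sum_le`) bounds both: the former oscillate little over a short relative
window around the deterministic index `m = ⌈r² ξ²⌉` (`exists_window_sum`), the latter have second
moment `O(n²)` and are negligible uniformly over the window (`eventually_window_meanDiffRem`). So
up to an event of small probability, coverage at `N_d` is sandwiched between the events that the
standardised sum at index `m` is at most `(z ± ε) √m` in absolute value
(`eventually_coverage_sandwich`), and the central limit theorem at `m` gives the limit
`2 Φ(z) - 1 = 1 - α`.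
-/

namespace GiniSeq

/-! ### Mean distances to a point: uniform law of large numbers -/

/-- The mean distance `g t = E|t - X|` from `t` to a variable of law `F`. -/
noncomputable def meanDist (F : Measure ℝ) (t : ℝ) : ℝ := ∫ y, |t - y| ∂F

/-- The mean distance from `t` to the first `n` terms of `x`, the empirical version of
`meanDist` (with value `0` for `n = 0`). -/
noncomputable def empDist (x : ℕ → ℝ) (n : ℕ) (t : ℝ) : ℝ :=
  (∑ i ∈ Finset.range n, |t - x i|) / n

lemma meanDist_nonneg (F : Measure ℝ) (t : ℝ) : 0 ≤ meanDist F t :=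
  integral_nonneg fun _ => abs_nonneg _

section MeanDist

variable {F : Measure ℝ} [IsProbabilityMeasure F]

lemma integrable_abs_sub (hF : Integrable (fun x : ℝ => x) F) (t : ℝ) :
    Integrable (fun y => |t - y|) F :=
  ((integrable_const t).sub hF).abs

lemma abs_meanDist_sub_le (hF : Integrable (fun x : ℝ => x) F) (s t : ℝ) :
    |meanDist F s - meanDist F t| ≤ |s - t| := by
  unfold meanDist
  rw [← integral_sub (integrable_abs_sub hF s) (integrable_abs_sub hF t), ← Real.norm_eq_abs]
  refine (norm_integral_le_of_norm_le_const (C := |s - t|) (ae_of_all _ fun y => ?_)).trans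
    (by simp)
  rw [Real.norm_eq_abs]
  simpa using abs_abs_sub_abs_le_abs_sub (s - y) (t - y)

lemma continuous_meanDist (hF : Integrable (fun x : ℝ => x) F) : Continuous (meanDist F) := by
  refine (LipschitzWith.of_dist_le_mul (K := 1) fun s t => ?_).continuous
  simpa [Real.dist_eq] using abs_meanDist_sub_le hF s t

lemma meanDist_sub_add_eq (hF : Integrable (fun x : ℝ => x) F) (t : ℝ) :
    meanDist F t - t + popMean F = ∫ y, (|t - y| - t + y) ∂F := by
  have h := integral_add (f := fun y => |t - y| - t) (g := fun y => y)
    ((integrable_abs_sub hF t).sub (integrable_const t)) hF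
  rw [h, integral_sub (integrable_abs_sub hF t) (integrable_const t)]
  simp [meanDist, popMean]

lemma meanDist_sub_add_nonneg (hF : Integrable (fun x : ℝ => x) F) (t : ℝ) :
    0 ≤ meanDist F t - t + popMean F := by
  rw [meanDist_sub_add_eq hF]
  exact integral_nonneg fun y => by
    have := le_abs_self (t - y)
    simp only [Pi.zero_apply]
    linarith

lemma meanDist_sub_antitone (hF : Integrable (fun x : ℝ => x) F) :
    Antitone fun t => meanDist F t - t + popMean F := by
  intro s t hst
  have := (abs_le.1 (abs_meanDist_sub_le hF t s)).2
  rw [abs_of_nonneg (sub_nonneg.2 hst)] at this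
  simp only
  linarith

lemma tendsto_meanDist_sub_add (hF : Integrable (fun x : ℝ => x) F) :
    Tendsto (fun t => meanDist F t - t + popMean F) atTop (𝓝 0) := by
  simp_rw [meanDist_sub_add_eq hF]
  have h0 : (∫ _ : ℝ, (0 : ℝ) ∂F) = 0 := by simp
  rw [← h0]
  refine tendsto_integral_filter_of_dominated_convergence (fun y => 2 * |y|)
    (Eventually.of_forall fun t =>
      ((((integrable_abs_sub hF t).sub (integrable_const t)).add hF).aestronglyMeasurable))
    ?_ (hF.abs.const_mul 2) (ae_of_all _ fun y => ?_)
  · filter_upwards [eventually_ge_atTop 0] with t ht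
    refine ae_of_all _ fun y => ?_
    rw [Real.norm_eq_abs, abs_le]
    have h1 := abs_sub t y
    have h2 := le_abs_self y
    have h3 := neg_abs_le y
    have h4 := le_abs_self (t - y)
    rw [abs_of_nonneg ht] at h1
    constructor <;> linarith [abs_nonneg y]
  · refine tendsto_const_nhds.congr' ?_
    filter_upwards [eventually_ge_atTop y] with t ht
    rw [abs_of_nonneg (sub_nonneg.2 ht)]
    ring

end MeanDist

lemma abs_empDist_sub_le (x : ℕ → ℝ) (n : ℕ) (s t : ℝ) :
    |empDist x n s - empDist x n t| ≤ |s - t| := by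
  rcases Nat.eq_zero_or_pos n with rfl | hn
  · simp [empDist]
  have hn' : (0 : ℝ) < n := by exact_mod_cast hn
  unfold empDist
  rw [← sub_div, ← Finset.sum_sub_distrib, abs_div, abs_of_pos hn', div_le_iff₀ hn']
  refine (Finset.abs_sum_le_sum_abs _ _).trans ?_
  calc ∑ i ∈ Finset.range n, |(|s - x i| - |t - x i|)|
      ≤ ∑ i ∈ Finset.range n, |s - t| := Finset.sum_le_sum fun i _ => by
        simpa using abs_abs_sub_abs_le_abs_sub (s - x i) (t - x i)
    _ = |s - t| * n := by simp [mul_comm]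

lemma empDist_nonneg (x : ℕ → ℝ) (n : ℕ) (t : ℝ) : 0 ≤ empDist x n t :=
  div_nonneg (Finset.sum_nonneg fun _ _ => abs_nonneg _) (Nat.cast_nonneg n)

lemma empDist_sub_antitone (x : ℕ → ℝ) (n : ℕ) :
    Antitone fun t => empDist x n t - t + sampleMean x n := by
  intro s t hst
  have := (abs_le.1 (abs_empDist_sub_le x n t s)).2
  rw [abs_of_nonneg (sub_nonneg.2 hst)] at this
  simp only
  linarith

lemma empDist_sub_add_nonneg (x : ℕ → ℝ) {n : ℕ} (hn : 0 < n) (t : ℝ) :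
    0 ≤ empDist x n t - t + sampleMean x n := by
  have hn' : (0 : ℝ) < n := by exact_mod_cast hn
  have : empDist x n t - t + sampleMean x n
      = (∑ i ∈ Finset.range n, (|t - x i| - t + x i)) / n := by
    rw [Finset.sum_add_distrib, Finset.sum_sub_distrib]
    simp only [empDist, sampleMean, Finset.sum_const, Finset.card_range, nsmul_eq_mul]
    field_simp
  rw [this]
  refine div_nonneg (Finset.sum_nonneg fun i _ => ?_) hn'.le
  have := le_abs_self (t - x i)
  linarith

/-- A Pólya-type upgrade of pointwise to uniform convergence on the half-line. Both
`empDist x n t - t + sampleMean x n` and its limit are nonnegative and decreasing in `t`, and the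
limit vanishes at infinity; this controls large `t`, and the Lipschitz bound reduces bounded `t`
to finitely many rational points. -/
theorem eventually_abs_empDist_sub_le {F : Measure ℝ} [IsProbabilityMeasure F]
    (hF : Integrable (fun x : ℝ => x) F) {x : ℕ → ℝ}
    (hq : ∀ q : ℚ, Tendsto (fun n => empDist x n q) atTop (𝓝 (meanDist F q)))
    (hmean : Tendsto (sampleMean x) atTop (𝓝 (popMean F))) {ε : ℝ} (hε : 0 < ε) :
    ∀ᶠ n in atTop, ∀ t : ℝ, 0 ≤ t → |empDist x n t - meanDist F t| ≤ ε := by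
  set δ := ε / 4 with hδ
  have hδ0 : 0 < δ := by positivity
  obtain ⟨K, hK⟩ : ∃ K : ℕ, meanDist F K - K + popMean F ≤ δ :=
    (((tendsto_meanDist_sub_add hF).comp tendsto_natCast_atTop_atTop).eventually_le_const
      hδ0).exists
  obtain ⟨m, hm⟩ := exists_nat_gt (1 / δ)
  have hm0 : (0 : ℝ) < m := lt_trans (by positivity) hm
  have hm1 : 1 / (m : ℝ) ≤ δ := by
    rw [div_le_iff₀ hm0]; rw [div_lt_iff₀ hδ0] at hm; linarith
  have hgrid : ∀ᶠ n in atTop, ∀ j ∈ Finset.range (K * m + 1),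
      |empDist x n ((j / m : ℚ) : ℝ) - meanDist F ((j / m : ℚ) : ℝ)| ≤ δ := by
    rw [eventually_all_finset]
    intro j _
    have := (hq (j / m)).sub_const (meanDist F ((j / m : ℚ) : ℝ))
    rw [sub_self] at this
    simpa using this.abs.eventually_le_const (by simpa using hδ0)
  have hmean' : ∀ᶠ n in atTop, |sampleMean x n - popMean F| ≤ δ := by
    have := hmean.sub_const (popMean F)
    rw [sub_self] at this
    simpa using this.abs.eventually_le_const (by simpa using hδ0)
  filter_upwards [hgrid, hmean', eventually_gt_atTop 0] with n hn hmn hn0 t ht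
  obtain hle | hgt := le_or_gt t K
  · set j := ⌊t * m⌋₊ with hj
    have hjm : j ∈ Finset.range (K * m + 1) := by
      rw [Finset.mem_range, Nat.lt_succ_iff, hj]
      refine Nat.floor_le_of_le ?_
      push_cast
      exact mul_le_mul_of_nonneg_right hle hm0.le
    have h1 := hn j hjm
    push_cast at h1
    have hd : |t - j / m| ≤ δ := by
      have ha := Nat.floor_le (mul_nonneg ht hm0.le)
      have hb := Nat.lt_floor_add_one (t * m)
      rw [← hj] at ha hb
      have h2 : t - j / m = (t * m - j) / m := by field_simp
      rw [h2, abs_of_nonneg (div_nonneg (by linarith) hm0.le)]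
      refine le_trans ?_ hm1
      gcongr
      linarith
    have h3 := (abs_empDist_sub_le x n t (j / m)).trans hd
    have h4 := (abs_meanDist_sub_le hF t (j / m)).trans hd
    rw [abs_le] at *
    constructor <;> linarith [h1.1, h1.2, h3.1, h3.2, h4.1, h4.2]
  · have hKn := hn (K * m) (by simp)
    have hcast : (((((K * m : ℕ) : ℚ) / (m : ℚ)) : ℚ) : ℝ) = K := by
      push_cast
      field_simp
    rw [hcast] at hKn
    have h1 := meanDist_sub_add_nonneg hF t
    have h2 := meanDist_sub_antitone hF hgt.le
    have h3 := empDist_sub_add_nonneg x hn0 t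
    have h4 := empDist_sub_antitone x n hgt.le
    simp only at h2 h4
    rw [abs_le] at *
    constructor <;> linarith [hmn.1, hmn.2, hKn.1, hKn.2]

/-! ### Sample quantities in terms of mean distances -/

lemma sum_pairs (f : ℕ → ℕ → ℝ) (n : ℕ) :
    ∑ p ∈ pairs n, f p.1 p.2 = ∑ j ∈ Finset.range n, ∑ i ∈ Finset.range j, f i j := by
  rw [pairs, Finset.sum_filter, Finset.sum_product_right]
  refine Finset.sum_congr rfl fun j hj => ?_
  rw [← Finset.sum_filter]
  refine Finset.sum_congr ?_ fun _ _ => rfl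
  ext i
  simp only [Finset.mem_filter, Finset.mem_range] at *
  omega

lemma two_mul_sum_pairs {f : ℕ → ℕ → ℝ} (hsymm : ∀ i j, f i j = f j i) (hdiag : ∀ i, f i i = 0)
    (n : ℕ) :
    2 * ∑ p ∈ pairs n, f p.1 p.2 = ∑ j ∈ Finset.range n, ∑ i ∈ Finset.range n, f i j := by
  rw [sum_pairs]
  induction n with
  | zero => simp
  | succ n ih =>
    simp_rw [Finset.sum_range_succ (n := n), Finset.sum_add_distrib, mul_add, ih, hdiag]
    have : ∑ j ∈ Finset.range n, f n j = ∑ j ∈ Finset.range n, f j n :=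
      Finset.sum_congr rfl fun j _ => hsymm _ _
    rw [this]
    ring

lemma sum_abs_sub_eq (x : ℕ → ℝ) {n : ℕ} (hn : 0 < n) (t : ℝ) :
    ∑ i ∈ Finset.range n, |t - x i| = n * empDist x n t := by
  have hn' : (n : ℝ) ≠ 0 := by exact_mod_cast hn.ne'
  rw [empDist]
  field_simp

lemma sum_pairs_abs_sub (x : ℕ → ℝ) {n : ℕ} (hn : 0 < n) :
    2 * ∑ p ∈ pairs n, |x p.1 - x p.2| = n * ∑ j ∈ Finset.range n, empDist x n (x j) := by
  rw [two_mul_sum_pairs (f := fun i j => |x i - x j|) (fun i j => abs_sub_comm _ _) (by simp),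
    Finset.mul_sum]
  refine Finset.sum_congr rfl fun j _ => ?_
  rw [← sum_abs_sub_eq x hn]
  exact Finset.sum_congr rfl fun i _ => abs_sub_comm _ _

lemma sampleMeanDiff_eq (x : ℕ → ℝ) {n : ℕ} (hn : 2 ≤ n) :
    sampleMeanDiff x n = n / (n - 1) * ((∑ j ∈ Finset.range n, empDist x n (x j)) / n) := by
  have h := sum_pairs_abs_sub x (n := n) (by omega)
  have hn' : (2 : ℝ) ≤ n := by exact_mod_cast hn
  rw [sampleMeanDiff, Nat.cast_choose_two]
  have h1 : (n : ℝ) - 1 ≠ 0 := by linarith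
  have h2 : (n : ℝ) ≠ 0 := by linarith
  field_simp
  linarith

lemma sampleTau_eq (x : ℕ → ℝ) {n : ℕ} (hn : 2 ≤ n) :
    sampleTau x n = n / (n - 1) * ((∑ j ∈ Finset.range n, x j * empDist x n (x j)) / n) := by
  have hn' : (2 : ℝ) ≤ n := by exact_mod_cast hn
  have h : 2 * ∑ p ∈ pairs n, 1 / 2 * (x p.1 + x p.2) * |x p.1 - x p.2|
      = n * ∑ j ∈ Finset.range n, x j * empDist x n (x j) := by
    rw [two_mul_sum_pairs (f := fun i j => 1 / 2 * (x i + x j) * |x i - x j|)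
      (fun i j => by rw [abs_sub_comm]; ring) (by simp)]
    have h1 : ∀ i j, 1 / 2 * (x i + x j) * |x i - x j|
        = 1 / 2 * (x i * |x i - x j|) + 1 / 2 * (x j * |x j - x i|) := fun i j => by
      rw [abs_sub_comm (x j)]; ring
    simp_rw [h1, Finset.sum_add_distrib, ← Finset.mul_sum]
    rw [Finset.sum_comm]
    simp_rw [← Finset.mul_sum, sum_abs_sub_eq x (show 0 < n by omega)]
    rw [Finset.mul_sum (Finset.range n) _ (n : ℝ)]
    rw [← add_mul, show (1 / 2 + 1 / 2 : ℝ) = 1 by norm_num, one_mul]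
    exact Finset.sum_congr rfl fun j _ => by ring
  rw [sampleTau]
  have h1 : (n : ℝ) - 1 ≠ 0 := by linarith
  have h2 : (n : ℝ) ≠ 0 := by linarith
  rw [div_mul_eq_mul_div, h]
  field_simp

lemma sum_pairs_ne {f : ℕ → ℕ → ℝ} (hsymm : ∀ i j, f i j = f j i) (hdiag : ∀ i, f i i = 0)
    {n j : ℕ} (hj : j < n) :
    ∑ p ∈ (pairs n).filter (fun p => p.1 ≠ j ∧ p.2 ≠ j), f p.1 p.2
      = ∑ p ∈ pairs n, f p.1 p.2 - ∑ i ∈ Finset.range n, f j i := by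
  have h1 := two_mul_sum_pairs hsymm hdiag n
  have h2 := two_mul_sum_pairs (f := fun a b => if a ≠ j ∧ b ≠ j then f a b else 0)
    (fun a b => by simp only [and_comm, hsymm]) (by simp [hdiag]) n
  have h3 : ∀ b, ∑ a ∈ Finset.range n, (if a ≠ j ∧ b ≠ j then f a b else 0)
      = if b ≠ j then (∑ a ∈ Finset.range n, f a b) - f j b else 0 := by
    intro b
    by_cases hb : b = j
    · simp [hb]
    · simp only [hb, ne_eq, not_false_eq_true, and_true, if_true]
      rw [← Finset.sum_filter, Finset.filter_ne',
        ← Finset.sum_erase_add _ _ (Finset.mem_range.2 hj)]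
      ring
  simp_rw [h3] at h2
  rw [← Finset.sum_filter, ← Finset.sum_filter (fun b => b ≠ j), Finset.filter_ne',
    Finset.sum_erase_eq_sub (Finset.mem_range.2 hj),
    Finset.sum_sub_distrib, hdiag, ← h1] at h2
  have h4 : ∑ i ∈ Finset.range n, f i j = ∑ i ∈ Finset.range n, f j i :=
    Finset.sum_congr rfl fun i _ => hsymm _ _
  rw [h4] at h2
  linarith

/-- Deleting `x j` removes the sum of its distances, so the pseudo-value `W_{jn}` is twice the
(suitably normalised) mean distance of `x j` to the sample. -/
lemma pseudoValue_eq (x : ℕ → ℝ) {n j : ℕ} (hn : 3 ≤ n) (hj : j < n) :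
    pseudoValue x n j = 2 * (n / (n - 1)) * empDist x n (x j) := by
  have hn' : (3 : ℝ) ≤ n := by exact_mod_cast hn
  rw [pseudoValue, sampleMeanDiff, deletedMeanDiff,
    sum_pairs_ne (f := fun a b => |x a - x b|) (fun a b => abs_sub_comm _ _) (by simp) hj,
    sum_abs_sub_eq x (by omega), Nat.cast_choose_two, Nat.cast_choose_two,
    Nat.cast_sub (by omega)]
  have h1 : (n : ℝ) - 1 ≠ 0 := by linarith
  have h2 : (n : ℝ) ≠ 0 := by linarith
  have h3 : (n : ℝ) - 2 ≠ 0 := by linarith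
  push_cast
  have h4 : (n : ℝ) - 1 - 1 ≠ 0 := by intro h; apply h3; linarith
  field_simp
  ring

lemma sum_sub_mean_sq (y : ℕ → ℝ) {n : ℕ} (hn : 0 < n) :
    ∑ j ∈ Finset.range n, (y j - (∑ i ∈ Finset.range n, y i) / n) ^ 2
      = n * ((∑ j ∈ Finset.range n, y j ^ 2) / n - ((∑ i ∈ Finset.range n, y i) / n) ^ 2) := by
  have hn' : (n : ℝ) ≠ 0 := by exact_mod_cast hn.ne'
  set S := ∑ i ∈ Finset.range n, y i with hS
  have : ∀ j, (y j - S / n) ^ 2 = y j ^ 2 - 2 * (S / n) * y j + (S / n) ^ 2 := fun j => by ring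
  simp_rw [this]
  rw [Finset.sum_add_distrib, Finset.sum_sub_distrib, ← Finset.mul_sum, ← hS]
  simp only [Finset.sum_const, Finset.card_range, nsmul_eq_mul]
  field_simp
  ring

lemma sampleVar_eq (x : ℕ → ℝ) {n : ℕ} (hn : 0 < n) :
    sampleVar x n
      = n / (n - 1) * ((∑ j ∈ Finset.range n, x j ^ 2) / n - sampleMean x n ^ 2) := by
  rw [sampleVar, sampleMean, sum_sub_mean_sq x hn]
  ring

lemma pseudoVar_eq (x : ℕ → ℝ) {n : ℕ} (hn : 3 ≤ n) :
    pseudoVar x n = 4 * (n / (n - 1)) ^ 3 * ((∑ j ∈ Finset.range n, empDist x n (x j) ^ 2) / n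
      - ((∑ j ∈ Finset.range n, empDist x n (x j)) / n) ^ 2) := by
  rw [pseudoVar, sum_sub_mean_sq _ (by omega)]
  have h1 : ∑ j ∈ Finset.range n, pseudoValue x n j
      = 2 * (n / (n - 1)) * ∑ j ∈ Finset.range n, empDist x n (x j) := by
    rw [Finset.mul_sum]
    exact Finset.sum_congr rfl fun j hj => pseudoValue_eq x hn (Finset.mem_range.1 hj)
  have h2 : ∑ j ∈ Finset.range n, pseudoValue x n j ^ 2
      = (2 * (n / (n - 1))) ^ 2 * ∑ j ∈ Finset.range n, empDist x n (x j) ^ 2 := by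
    rw [Finset.mul_sum]
    exact Finset.sum_congr rfl fun j hj => by
      rw [pseudoValue_eq x hn (Finset.mem_range.1 hj), mul_pow]
  rw [h1, h2]
  ring

/-! ### Consistency of the variance estimator -/

lemma tendsto_natCast_div_sub_one :
    Tendsto (fun n : ℕ => (n : ℝ) / ((n : ℝ) - 1)) atTop (𝓝 1) := by
  have h : Tendsto (fun n : ℕ => 1 + 1 / ((n : ℝ) - 1)) atTop (𝓝 (1 + 0)) := by
    refine tendsto_const_nhds.add (Tendsto.div_atTop tendsto_const_nhds ?_)
    exact tendsto_atTop_add_const_right _ _ tendsto_natCast_atTop_atTop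
  rw [add_zero] at h
  refine h.congr' ?_
  filter_upwards [eventually_ge_atTop 2] with n hn
  have hn' : (2 : ℝ) ≤ n := by exact_mod_cast hn
  have : (n : ℝ) - 1 ≠ 0 := by linarith
  field_simp
  ring

/-- If `|u n - v n| ≤ ε * w n` eventually, for every small `ε`, with `v` and `w` convergent, then
`u` has the same limit as `v`. -/
lemma tendsto_of_forall_eventually_abs_sub_le {u v w : ℕ → ℝ} {l L : ℝ}
    (hv : Tendsto v atTop (𝓝 l)) (hw : Tendsto w atTop (𝓝 L))
    (h : ∀ ε : ℝ, 0 < ε → ε ≤ 1 → ∀ᶠ n in atTop, |u n - v n| ≤ ε * w n) :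
    Tendsto u atTop (𝓝 l) := by
  have h0 : Tendsto (fun n => u n - v n) atTop (𝓝 0) := by
    rw [Metric.tendsto_atTop']
    have hL : (0 : ℝ) < |L| + 1 := by positivity
    intro ε hε
    have hε' : 0 < min 1 (ε / (2 * (|L| + 1))) := by positivity
    have h1 := h _ hε' (min_le_left _ _)
    have h2 := hw.eventually_le_const (show L < |L| + 1 by linarith [le_abs_self L])
    obtain ⟨N, hN⟩ := eventually_atTop.1 (h1.and h2)
    refine ⟨N, fun n hn => ?_⟩
    obtain ⟨h3, h4⟩ := hN n hn.le
    rw [Real.dist_eq, sub_zero]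
    calc |u n - v n| ≤ _ := h3
      _ ≤ min 1 (ε / (2 * (|L| + 1))) * (|L| + 1) := by gcongr
      _ ≤ (ε / (2 * (|L| + 1))) * (|L| + 1) := by gcongr; exact min_le_right _ _
      _ = ε / 2 := by field_simp
      _ < ε := by linarith
  simpa using h0.add hv

section Consistency

variable {F : Measure ℝ} [IsProbabilityMeasure F]

/-- The sequence `x` is typical for `F`: its terms are nonnegative, and its empirical means of
`t`, `t ^ 2`, `g t`, `t * g t`, `g t ^ 2` and `|q - t|` (for rational `q`) converge to the means
under `F`, where `g = meanDist F`. -/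
structure IsTypical (F : Measure ℝ) (x : ℕ → ℝ) : Prop where
  nonneg : ∀ i, 0 ≤ x i
  mean : Tendsto (sampleMean x) atTop (𝓝 (popMean F))
  sq : Tendsto (fun n : ℕ => (∑ i ∈ Finset.range n, x i ^ 2) / n) atTop (𝓝 (∫ t, t ^ 2 ∂F))
  dist : Tendsto (fun n : ℕ => (∑ i ∈ Finset.range n, meanDist F (x i)) / n) atTop
    (𝓝 (∫ t, meanDist F t ∂F))
  mul_dist : Tendsto (fun n : ℕ => (∑ i ∈ Finset.range n, x i * meanDist F (x i)) / n) atTop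
    (𝓝 (∫ t, t * meanDist F t ∂F))
  dist_sq : Tendsto (fun n : ℕ => (∑ i ∈ Finset.range n, meanDist F (x i) ^ 2) / n) atTop
    (𝓝 (∫ t, meanDist F t ^ 2 ∂F))
  emp : ∀ q : ℚ, Tendsto (fun n => empDist x n q) atTop (𝓝 (meanDist F q))

lemma abs_sum_div_sub_sum_div_le {n : ℕ} {a b c : ℕ → ℝ} {ε : ℝ}
    (h : ∀ i ∈ Finset.range n, |a i - b i| ≤ ε * c i) :
    |(∑ i ∈ Finset.range n, a i) / n - (∑ i ∈ Finset.range n, b i) / n|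
      ≤ ε * ((∑ i ∈ Finset.range n, c i) / n) := by
  rw [← sub_div, ← Finset.sum_sub_distrib, abs_div, Nat.abs_cast, ← mul_div_assoc,
    Finset.mul_sum]
  gcongr
  exact (Finset.abs_sum_le_sum_abs _ _).trans (Finset.sum_le_sum h)

lemma IsTypical.tendsto_sum_empDist (hF : Integrable (fun x : ℝ => x) F) {x : ℕ → ℝ}
    (hx : IsTypical F x) :
    Tendsto (fun n : ℕ => (∑ i ∈ Finset.range n, empDist x n (x i)) / n) atTop
      (𝓝 (∫ t, meanDist F t ∂F)) := by
  have h1 : Tendsto (fun n : ℕ => (∑ i ∈ Finset.range n, (1 : ℝ)) / n) atTop (𝓝 1) := by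
    refine tendsto_const_nhds.congr' ?_
    filter_upwards [eventually_gt_atTop 0] with n hn
    have : (n : ℝ) ≠ 0 := by exact_mod_cast hn.ne'
    simp [this]
  refine tendsto_of_forall_eventually_abs_sub_le hx.dist h1 fun ε hε _ => ?_
  filter_upwards [eventually_abs_empDist_sub_le hF hx.emp hx.mean hε] with n hn
  exact abs_sum_div_sub_sum_div_le fun i _ => by simpa using hn (x i) (hx.nonneg i)

lemma IsTypical.tendsto_sum_mul_empDist (hF : Integrable (fun x : ℝ => x) F) {x : ℕ → ℝ}
    (hx : IsTypical F x) :
    Tendsto (fun n : ℕ => (∑ i ∈ Finset.range n, x i * empDist x n (x i)) / n) atTop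
      (𝓝 (∫ t, t * meanDist F t ∂F)) := by
  refine tendsto_of_forall_eventually_abs_sub_le hx.mul_dist hx.mean fun ε hε _ => ?_
  filter_upwards [eventually_abs_empDist_sub_le hF hx.emp hx.mean hε] with n hn
  refine abs_sum_div_sub_sum_div_le fun i _ => ?_
  rw [← mul_sub, abs_mul, abs_of_nonneg (hx.nonneg i), mul_comm]
  exact mul_le_mul_of_nonneg_right (hn (x i) (hx.nonneg i)) (hx.nonneg i)

lemma IsTypical.tendsto_sum_empDist_sq (hF : Integrable (fun x : ℝ => x) F) {x : ℕ → ℝ}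
    (hx : IsTypical F x) :
    Tendsto (fun n : ℕ => (∑ i ∈ Finset.range n, empDist x n (x i) ^ 2) / n) atTop
      (𝓝 (∫ t, meanDist F t ^ 2 ∂F)) := by
  refine tendsto_of_forall_eventually_abs_sub_le hx.dist_sq
    (hx.dist.add (hx.tendsto_sum_empDist hF)) fun ε hε _ => ?_
  filter_upwards [eventually_abs_empDist_sub_le hF hx.emp hx.mean hε] with n hn
  rw [← add_div, ← Finset.sum_add_distrib]
  refine abs_sum_div_sub_sum_div_le fun i _ => ?_
  have h1 := meanDist_nonneg F (x i)
  have h2 := empDist_nonneg x n (x i)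
  rw [sq_sub_sq, abs_mul, mul_comm, abs_of_nonneg (by linarith : 0 ≤ empDist x n (x i) +
    meanDist F (x i)), add_comm (empDist x n (x i))]
  exact mul_le_mul_of_nonneg_right (hn (x i) (hx.nonneg i)) (by linarith)

lemma popMeanDiff_eq (hF : Integrable (fun x : ℝ => x) F) :
    popMeanDiff F = ∫ t, meanDist F t ∂F := by
  have h : Integrable (fun p : ℝ × ℝ => |p.1 - p.2|) (F.prod F) :=
    ((hF.comp_fst F).sub (hF.comp_snd F)).abs
  rw [popMeanDiff, integral_prod _ h]
  rfl

lemma IsTypical.tendsto_sampleMeanDiff (hF : Integrable (fun x : ℝ => x) F) {x : ℕ → ℝ}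
    (hx : IsTypical F x) : Tendsto (sampleMeanDiff x) atTop (𝓝 (popMeanDiff F)) := by
  have h := tendsto_natCast_div_sub_one.mul (hx.tendsto_sum_empDist hF)
  rw [one_mul, ← popMeanDiff_eq hF] at h
  refine h.congr' ?_
  filter_upwards [eventually_ge_atTop 2] with n hn
  rw [sampleMeanDiff_eq x hn]

lemma abs_meanDist_le (hF : Integrable (fun x : ℝ => x) F) (t : ℝ) :
    |meanDist F t| ≤ |t| + meanDist F 0 := by
  have h1 := (abs_le.1 (abs_meanDist_sub_le hF t 0)).2
  rw [abs_of_nonneg (meanDist_nonneg F t)]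
  rw [sub_zero] at h1
  linarith

lemma memLp_meanDist (hF : MemLp (fun x : ℝ => x) 2 F) : MemLp (meanDist F) 2 F := by
  have h1 := hF.integrable (by norm_num)
  refine MemLp.of_le (hF.abs.add (memLp_const (meanDist F 0)))
    (continuous_meanDist h1).aestronglyMeasurable (ae_of_all _ fun t => ?_)
  refine (abs_meanDist_le h1 t).trans (le_abs_self _)

lemma popTau_eq (hF : MemLp (fun x : ℝ => x) 2 F) :
    popTau F = ∫ t, t * meanDist F t ∂F := by
  have h : Integrable (fun p : ℝ × ℝ => p.1 * |p.1 - p.2|) (F.prod F) := by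
    have h1 : MemLp (fun p : ℝ × ℝ => p.1) 2 (F.prod F) := hF.comp_fst F
    have h2 : MemLp (fun p : ℝ × ℝ => p.2) 2 (F.prod F) := hF.comp_snd F
    exact h1.integrable_mul (h1.sub h2).abs
  rw [popTau, integral_prod _ h]
  refine integral_congr_ae (ae_of_all _ fun t => ?_)
  simp only [meanDist]
  rw [integral_const_mul]

lemma popVar_eq (hF : MemLp (fun x : ℝ => x) 2 F) :
    popVar F = (∫ t, t ^ 2 ∂F) - popMean F ^ 2 := by
  rw [popVar, variance_eq_sub hF]
  rfl

lemma projVar_eq (hF : MemLp (fun x : ℝ => x) 2 F) :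
    projVar F = (∫ t, meanDist F t ^ 2 ∂F) - popMeanDiff F ^ 2 := by
  rw [popMeanDiff_eq (hF.integrable (by norm_num)), projVar]
  exact variance_eq_sub (memLp_meanDist hF)

/-- Along a typical sequence the estimator `Vₙ²` converges to `ξ²`. -/
theorem IsTypical.tendsto_varEst (hF : MemLp (fun x : ℝ => x) 2 F) (hμ : 0 < popMean F)
    {x : ℕ → ℝ} (hx : IsTypical F x) : Tendsto (varEst x) atTop (𝓝 (asympVar F)) := by
  have hF1 := hF.integrable (by norm_num)
  have hD := hx.tendsto_sampleMeanDiff hF1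
  have hr := tendsto_natCast_div_sub_one
  have hS : Tendsto (sampleVar x) atTop (𝓝 (popVar F)) := by
    have h := hr.mul (hx.sq.sub (hx.mean.pow 2))
    rw [one_mul, ← popVar_eq hF] at h
    refine h.congr' ?_
    filter_upwards [eventually_gt_atTop 0] with n hn
    rw [sampleVar_eq x hn]
  have hT : Tendsto (sampleTau x) atTop (𝓝 (popTau F)) := by
    have h := hr.mul (hx.tendsto_sum_mul_empDist hF1)
    rw [one_mul, ← popTau_eq hF] at h
    refine h.congr' ?_
    filter_upwards [eventually_ge_atTop 2] with n hn
    rw [sampleTau_eq x hn]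
  have hW : Tendsto (pseudoVar x) atTop (𝓝 (4 * projVar F)) := by
    have h := ((hr.pow 3).const_mul 4).mul ((hx.tendsto_sum_empDist_sq hF1).sub
      ((hx.tendsto_sum_empDist hF1).pow 2))
    rw [← popMeanDiff_eq hF1, ← projVar_eq hF, one_pow, mul_one] at h
    refine h.congr' ?_
    filter_upwards [eventually_ge_atTop 3] with n hn
    rw [pseudoVar_eq x hn]
  have h1 : 4 * popMean F ^ 4 ≠ 0 := by positivity
  have h2 : popMean F ^ 3 ≠ 0 := by positivity
  have h3 : popMean F ^ 2 ≠ 0 := by positivity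
  have h4 : 4 * popMean F ^ 2 ≠ 0 := by positivity
  have := (((((hD.pow 2).mul hS).div ((hx.mean.pow 4).const_mul 4) h1).sub
    ((hD.div (hx.mean.pow 3) h2).mul hT)).add ((hD.pow 2).div (hx.mean.pow 2) h3)).add
    (hW.div ((hx.mean.pow 2).const_mul 4) h4)
  have e : popMeanDiff F ^ 2 * popVar F / (4 * popMean F ^ 4)
      - popMeanDiff F / popMean F ^ 3 * popTau F + popMeanDiff F ^ 2 / popMean F ^ 2
      + 4 * projVar F / (4 * popMean F ^ 2) = asympVar F := by
    rw [asympVar]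
    field_simp
  rw [← e]
  exact this

end Consistency

/-! ### The stopping time for small `d` -/

lemma stopTime_eq_sInf {α d : ℝ} {x : ℕ → ℝ} (h : (stopSet α d x).Nonempty) :
    stopTime α d x = ((sInf (stopSet α d x) : ℕ) : ℕ∞) :=
  (ENat.natCast_sInf h).symm

lemma stopSet_nonempty (α d : ℝ) {x : ℕ → ℝ} {C : ℝ}
    (h : ∀ᶠ n in atTop, varEst x n ≤ C ∧ sampleMean x n ≠ 0) : (stopSet α d x).Nonempty := by
  set r := upperQuantile (α / 2) / d
  obtain ⟨n, ⟨hV, h0⟩, hn1, hn2, hn3⟩ := (h.and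
    ((tendsto_natCast_atTop_atTop.eventually_ge_atTop (max 4 r)).and
    ((tendsto_natCast_atTop_atTop.eventually_ge_atTop (r ^ 2 * (C + 1))).and
    (eventually_ge_atTop 1)))).exists
  refine ⟨n, hn1, h0, le_trans ?_ hn2⟩
  have h1 : (1 : ℝ) ≤ n := by exact_mod_cast hn3
  have h2 : (n : ℝ)⁻¹ ≤ 1 := inv_le_one_of_one_le₀ h1
  gcongr

/-- If the variance estimator is within `ε` of `v` from the index `K` on, then for small `d` the
stopping time is close to `v (z / d) ^ 2`. The lower bound is the stopping rule at `N`; the upper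
bound comes from its failure at `N - 1`. -/
theorem eventually_stopTime_close {α v ε : ℝ} (hz : 0 < upperQuantile (α / 2)) (hv : 0 < v)
    (hε : 0 < ε) (K : ℕ) :
    ∀ᶠ d in 𝓝[>] (0 : ℝ), ∀ x : ℕ → ℝ,
      (∀ n, K ≤ n → |varEst x n - v| ≤ ε ∧ sampleMean x n ≠ 0) →
      ∃ N : ℕ, stopTime α d x = N ∧ K ≤ N ∧
        |N / (upperQuantile (α / 2) / d) ^ 2 - v| ≤ 2 * ε := by
  have hr : Tendsto (fun d : ℝ => upperQuantile (α / 2) / d) (𝓝[>] 0) atTop :=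
    tendsto_inv_nhdsGT_zero.const_mul_atTop hz
  filter_upwards [hr.eventually_ge_atTop (max (K + 5) (1 + 3 / ε))] with d hd x hx
  set r := upperQuantile (α / 2) / d with hrdef
  have hrK : (K : ℝ) + 5 ≤ r := (le_max_left _ _).trans hd
  have hrε : 1 + 3 / ε ≤ r := (le_max_right _ _).trans hd
  have hK0 : (0 : ℝ) ≤ K := Nat.cast_nonneg K
  have hr0 : 0 < r := by linarith
  have hne : (stopSet α d x).Nonempty := stopSet_nonempty α d (C := v + ε) <| by
    filter_upwards [eventually_ge_atTop K] with n hn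
    exact ⟨by linarith [(abs_le.1 (hx n hn).1).2], (hx n hn).2⟩
  set N := sInf (stopSet α d x) with hN
  obtain ⟨hN1, -, hN2⟩ : N ∈ stopSet α d x := Nat.sInf_mem hne
  rw [← hrdef] at hN1 hN2
  have hNr : r ≤ N := (le_max_right _ _).trans hN1
  have hKN : K + 5 ≤ N := by
    have : ((K + 5 : ℕ) : ℝ) ≤ N := by push_cast; linarith
    exact_mod_cast this
  refine ⟨N, stopTime_eq_sInf hne, by omega, ?_⟩
  have hr2 : 0 < r ^ 2 := by positivity
  have hlow : v - ε ≤ N / r ^ 2 := by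
    rw [le_div_iff₀ hr2, mul_comm]
    refine le_trans ?_ hN2
    have := (abs_le.1 (hx N (by omega)).1).1
    have h2 : (0 : ℝ) ≤ (N : ℝ)⁻¹ := by positivity
    gcongr
    linarith
  have hpred : (N : ℝ) - 1 = ((N - 1 : ℕ) : ℝ) := by
    rw [Nat.cast_sub (by omega)]; simp
  have hr1 : 0 < r - 1 := by linarith
  have hup : (N : ℝ) ≤ 1 + r + r ^ 2 * (v + ε + 1 / (r - 1)) := by
    have hnot : N - 1 ∉ stopSet α d x := Nat.notMem_of_lt_sInf (by omega)
    have hpos : 0 ≤ r ^ 2 * (v + ε + 1 / (r - 1)) := by positivity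
    obtain ⟨hV, h0⟩ := hx (N - 1) (by omega)
    by_contra! hlt
    refine hnot ⟨?_, h0, ?_⟩
    · rw [← hrdef, ← hpred, max_le_iff]
      have : ((5 : ℕ) : ℝ) ≤ N := by exact_mod_cast (by omega : 5 ≤ N)
      push_cast at this
      constructor <;> linarith
    · rw [← hrdef]
      have h3 : ((N - 1 : ℕ) : ℝ)⁻¹ ≤ 1 / (r - 1) := by
        rw [← hpred, inv_eq_one_div]
        exact one_div_le_one_div_of_le hr1 (by linarith)
      calc r ^ 2 * (varEst x (N - 1) + ((N - 1 : ℕ) : ℝ)⁻¹)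
          ≤ r ^ 2 * (v + ε + 1 / (r - 1)) := by
            gcongr
            linarith [(abs_le.1 hV).2]
        _ ≤ ((N - 1 : ℕ) : ℝ) := by rw [← hpred]; linarith
  have hup' : N / r ^ 2 ≤ v + 2 * ε := by
    rw [div_le_iff₀ hr2]
    refine hup.trans ?_
    have ha : 3 ≤ (r - 1) * ε := by
      have : 3 / ε ≤ r - 1 := by linarith
      rwa [div_le_iff₀ hε] at this
    have hb : 1 / (r - 1) ≤ ε / 3 := by
      rw [div_le_iff₀ hr1]; linarith
    have hc : r ≤ r ^ 2 * (ε / 3) := by nlinarith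
    have he : r ^ 2 * (v + ε + 1 / (r - 1)) ≤ r ^ 2 * (v + ε + ε / 3) := by gcongr
    linarith
  rw [abs_le]
  constructor <;> linarith

/-! ### The standard normal law and the central limit theorem -/

lemma gaussianReal_singleton (c : ℝ) : gaussianReal 0 1 {c} = 0 := by
  have := nullSingletonClass_gaussianReal (μ := 0) (v := 1) one_ne_zero
  exact measure_singleton c

lemma continuous_cdf_gaussianReal : Continuous (cdf (gaussianReal 0 1)) := by
  rw [continuous_iff_continuousAt]
  intro c
  rw [(monotone_cdf _).continuousAt_iff_leftLim_eq_rightLim, StieltjesFunction.rightLim_eq]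
  have h1 := (cdf (gaussianReal 0 1)).measure_singleton c
  rw [measure_cdf, gaussianReal_singleton] at h1
  have h2 := ENNReal.ofReal_eq_zero.1 h1.symm
  exact le_antisymm ((monotone_cdf _).leftLim_le le_rfl) (by linarith)

lemma cdf_gaussianReal_neg (c : ℝ) :
    cdf (gaussianReal 0 1) (-c) = 1 - cdf (gaussianReal 0 1) c := by
  have h1 : (gaussianReal 0 1).real (Set.Iic (-c)) = (gaussianReal 0 1).real (Set.Ici c) := by
    have h := gaussianReal_map_neg (μ := 0) (v := 1)
    rw [neg_zero] at h
    conv_lhs => rw [← h]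
    rw [map_measureReal_apply (by fun_prop) measurableSet_Iic]
    congr 1
    ext y
    simp
  have h2 : (gaussianReal 0 1).real (Set.Ici c) = (gaussianReal 0 1).real (Set.Ioi c) := by
    have := nullSingletonClass_gaussianReal (μ := 0) (v := 1) one_ne_zero
    exact measureReal_congr Ioi_ae_eq_Ici.symm
  rw [cdf_eq_real, cdf_eq_real, h1, h2, ← Set.compl_Iic,
    probReal_compl_eq_one_sub measurableSet_Iic]

lemma gaussianReal_Icc {c : ℝ} (hc : 0 ≤ c) :
    (gaussianReal 0 1).real (Set.Icc (-c) c) = 2 * cdf (gaussianReal 0 1) c - 1 := by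
  have hn := nullSingletonClass_gaussianReal (μ := 0) (v := 1) one_ne_zero
  have h1 : Set.Ioc (-c) c = Set.Iic c \ Set.Iic (-c) := by
    ext y; simp [and_comm]
  rw [measureReal_congr Ioc_ae_eq_Icc.symm, h1, measureReal_sdiff
    (Set.Iic_subset_Iic.2 (by linarith)) measurableSet_Iic, ← cdf_eq_real, ← cdf_eq_real,
    cdf_gaussianReal_neg]
  ring

lemma cdf_upperQuantile {p : ℝ} (h0 : 0 < p) (h1 : p < 1) :
    cdf (gaussianReal 0 1) (upperQuantile p) = 1 - p := by
  set S := {z : ℝ | 1 - p ≤ cdf (gaussianReal 0 1) z} with hS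
  have hclosed : IsClosed S := isClosed_le continuous_const continuous_cdf_gaussianReal
  have hne : S.Nonempty :=
    ((tendsto_cdf_atTop (gaussianReal 0 1)).eventually_const_le (by linarith)).exists
  have hbdd : BddBelow S := by
    obtain ⟨b, hb⟩ := ((tendsto_cdf_atBot (gaussianReal 0 1)).eventually_lt_const
      (show (0 : ℝ) < 1 - p by linarith)).exists
    refine ⟨b, fun z hz => ?_⟩
    by_contra! hlt
    exact absurd (hz.trans (monotone_cdf _ hlt.le)) (not_le.2 hb)
  refine le_antisymm ?_ (hclosed.csInf_mem hne hbdd)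
  have h2 : Tendsto (cdf (gaussianReal 0 1)) (𝓝[<] (upperQuantile p))
      (𝓝 (cdf (gaussianReal 0 1) (upperQuantile p))) :=
    continuous_cdf_gaussianReal.continuousAt.tendsto.mono_left nhdsWithin_le_nhds
  refine le_of_tendsto h2 ?_
  filter_upwards [self_mem_nhdsWithin] with z hz
  by_contra! hlt
  exact absurd (csInf_le hbdd (show z ∈ S from hlt.le)) (not_le.2 hz)

lemma upperQuantile_pos {p : ℝ} (h0 : 0 < p) (h1 : p < 1 / 2) : 0 < upperQuantile p := by
  by_contra! h
  have h2 := monotone_cdf (gaussianReal 0 1) h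
  have h3 := cdf_gaussianReal_neg 0
  rw [neg_zero] at h3
  rw [cdf_upperQuantile h0 (by linarith)] at h2
  linarith

lemma tendsto_measureReal_abs_sum_le {Ω : Type*} [MeasurableSpace Ω] {P : Measure Ω}
    [IsProbabilityMeasure P] {Y : ℕ → Ω → ℝ} (hindep : iIndepFun Y P)
    (hident : ∀ i, IdentDistrib (Y i) (Y 0) P P) (h0 : P[Y 0] = 0) (h1 : P[Y 0 ^ 2] = 1)
    {c : ℝ} (hc : 0 ≤ c) :
    Tendsto (fun n : ℕ => P.real {ω | |∑ k ∈ Finset.range n, Y k ω| ≤ c * √n}) atTop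
      (𝓝 (2 * cdf (gaussianReal 0 1) c - 1)) := by
  have h := tendstoInDistribution_inv_sqrt_mul_sum (HasLaw.id (μ := gaussianReal 0 1)) h0 h1
    hindep hident
  have hfr : (gaussianReal 0 1).map id (frontier (Set.Icc (-c) c)) = 0 := by
    rw [frontier_Icc (by linarith), Measure.map_id]
    exact measure_union_null (gaussianReal_singleton _) (gaussianReal_singleton _)
  have h2 := ProbabilityMeasure.tendsto_measure_of_null_frontier_of_tendsto' h.tendsto hfr
  have hne : ((gaussianReal 0 1).map id) (Set.Icc (-c) c) ≠ ⊤ := by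
    rw [Measure.map_id]; exact measure_ne_top _ _
  have h3 := (ENNReal.tendsto_toReal hne).comp h2
  have h4 : (((gaussianReal 0 1).map id) (Set.Icc (-c) c)).toReal
      = 2 * cdf (gaussianReal 0 1) c - 1 := by
    rw [Measure.map_id]; exact gaussianReal_Icc hc
  rw [← h4]
  refine h3.congr' ?_
  filter_upwards [eventually_gt_atTop 0] with n hn
  have hs : 0 < √(n : ℝ) := Real.sqrt_pos.2 (by exact_mod_cast hn)
  simp only [Function.comp_apply, ProbabilityMeasure.coe_mk]
  rw [Measure.map_apply_of_aemeasurable (h.forall_aemeasurable n) measurableSet_Icc]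
  congr 2
  ext ω
  simp only [Set.mem_preimage, ← abs_le, Set.mem_Icc, Set.mem_ofPred_eq]
  rw [abs_mul, abs_of_pos (inv_pos.2 hs), inv_mul_le_iff₀ hs, mul_comm]

/-! ### A maximal inequality for sums of conditionally centred terms -/

section Maximal

variable {Ω : Type*} [MeasurableSpace Ω] {P : Measure Ω} [IsProbabilityMeasure P]
  {F : Measure ℝ} [IsProbabilityMeasure F] {X : ℕ → Ω → ℝ}

/-- If `φ v` has mean zero under the law of `X a` for every `v`, then so has
`φ (X i : i ∈ T) (X a)` when `a ∉ T`. No integrability is required, since the Bochner integral of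
a non-integrable function vanishes too. -/
lemma integral_comp_eq_zero_of_notMem (hmeas : ∀ i, Measurable (X i)) (hindep : iIndepFun X P)
    (hlaw : ∀ i, P.map (X i) = F) {T : Finset ℕ} {a : ℕ} (ha : a ∉ T)
    {φ : (T → ℝ) → ℝ → ℝ} (hφ : Measurable (Function.uncurry φ))
    (h0 : ∀ v, ∫ u, φ v u ∂F = 0) : ∫ ω, φ (fun i => X i ω) (X a ω) ∂P = 0 := by
  have hV : Measurable fun ω (i : T) => X i ω := measurable_pi_lambda _ fun i => hmeas i
  have hind : IndepFun (fun ω (i : T) => X i ω) (X a) P := by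
    have h := hindep.indepFun_finset T {a} (Finset.disjoint_singleton_right.2 ha) hmeas
    exact h.comp (ψ := fun v : (({a} : Finset ℕ) → ℝ) => v ⟨a, Finset.mem_singleton_self a⟩)
      measurable_id (measurable_pi_apply _)
  have hprod := hind.map_prod_eq_prod_map_map hV.aemeasurable (hmeas a).aemeasurable
  rw [hlaw] at hprod
  have h1 : ∫ ω, φ (fun i => X i ω) (X a ω) ∂P
      = ∫ p, Function.uncurry φ p ∂(P.map fun ω => ((fun i : T => X i ω), X a ω)) := by
    rw [integral_map (hV.prodMk (hmeas a)).aemeasurable hφ.aestronglyMeasurable]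
    rfl
  rw [h1, hprod]
  have := Measure.isProbabilityMeasure_map (μ := P) hV.aemeasurable
  by_cases hint : Integrable (Function.uncurry φ) ((P.map fun ω (i : T) => X i ω).prod F)
  · rw [integral_prod _ hint]
    simp [Function.uncurry, h0]
  · exact integral_undef hint

/-- The filtration whose `k`-th σ-algebra is generated by `X 0, …, X (k - 1)`. -/
def pastFiltration {Ω : Type*} [m : MeasurableSpace Ω] (X : ℕ → Ω → ℝ)
    (hmeas : ∀ i, Measurable (X i)) : Filtration ℕ m where
  seq k := MeasurableSpace.comap (fun ω (i : Finset.range k) => X i ω) inferInstance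
  mono' := by
    intro k l hkl
    have h : (fun ω (i : Finset.range k) => X i ω)
        = (fun (v : Finset.range l → ℝ) (i : Finset.range k) =>
            v ⟨i, Finset.range_mono hkl i.2⟩) ∘ fun ω (i : Finset.range l) => X i ω := rfl
    simp only
    rw [h, ← MeasurableSpace.comap_comp]
    refine MeasurableSpace.comap_mono ?_
    exact (measurable_pi_lambda _ fun i => measurable_pi_apply _).comap_le
  le' k := (measurable_pi_lambda _ fun i : Finset.range k => hmeas i).comap_le

lemma measurable_pastFiltration_past (hmeas : ∀ i, Measurable (X i)) (k : ℕ) :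
    Measurable[pastFiltration X hmeas k] fun ω (i : Finset.range k) => X i ω :=
  comap_measurable _

lemma measurable_pastFiltration_apply (hmeas : ∀ i, Measurable (X i)) {j k : ℕ} (hjk : j < k) :
    Measurable[pastFiltration X hmeas k] (X j) :=
  (measurable_pi_apply (⟨j, Finset.mem_range.2 hjk⟩ : Finset.range k)).comp
    (measurable_pastFiltration_past hmeas k)

variable {δ : (k : ℕ) → (Finset.range k → ℝ) → ℝ → ℝ}

lemma measurable_pastFiltration_sum (hmeas : ∀ i, Measurable (X i))
    (hδ : ∀ k, Measurable (Function.uncurry (δ k))) (n : ℕ) :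
    Measurable[pastFiltration X hmeas n]
      fun ω => ∑ k ∈ Finset.range n, δ k (fun i => X i ω) (X k ω) := by
  refine Finset.measurable_fun_sum _ fun k hk => ?_
  have hk := Finset.mem_range.1 hk
  have h1 : Measurable[pastFiltration X hmeas n] fun ω (i : Finset.range k) => X i ω :=
    (measurable_pastFiltration_past hmeas k).mono ((pastFiltration X hmeas).mono hk.le) le_rfl
  exact (hδ k).comp (h1.prodMk (measurable_pastFiltration_apply hmeas hk))

lemma integral_mul_innovation_eq_zero (hmeas : ∀ i, Measurable (X i)) (hindep : iIndepFun X P)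
    (hlaw : ∀ i, P.map (X i) = F) {k : ℕ} {φ : (Finset.range k → ℝ) → ℝ → ℝ}
    (hφ : Measurable (Function.uncurry φ)) (h0 : ∀ v, ∫ u, φ v u ∂F = 0) {W : Ω → ℝ}
    (hW : Measurable[pastFiltration X hmeas k] W) :
    ∫ ω, W ω * φ (fun i => X i ω) (X k ω) ∂P = 0 := by
  obtain ⟨ζ, hζ, rfl⟩ := Measurable.exists_eq_measurable_comp
    (f := fun ω (i : Finset.range k) => X i ω) hW
  refine integral_comp_eq_zero_of_notMem (φ := fun v u => ζ v * φ v u) hmeas hindep hlaw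
    (by simp) ((hζ.comp measurable_fst).mul hφ) fun v => ?_
  rw [integral_const_mul, h0, mul_zero]

/-- Kolmogorov's inequality for sums of `D k = δ k (X 0, …, X (k - 1)) (X k)`, where `δ k v` has
mean zero for every `v`: the partial sums form a square-integrable martingale, so their squares
form a submartingale, to which Doob's maximal inequality applies. -/
theorem measureReal_exists_le_abs_sum_le (hmeas : ∀ i, Measurable (X i))
    (hindep : iIndepFun X P) (hlaw : ∀ i, P.map (X i) = F)
    (hδ : ∀ k, Measurable (Function.uncurry (δ k))) (h0 : ∀ k v, ∫ u, δ k v u ∂F = 0)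
    (hL2 : ∀ k, MemLp (fun ω => δ k (fun i => X i ω) (X k ω)) 2 P) {ε : ℝ} (hε : 0 < ε) (n : ℕ) :
    P.real {ω | ∃ k ≤ n, ε ≤ |∑ j ∈ Finset.range k, δ j (fun i => X i ω) (X j ω)|}
      ≤ (∑ k ∈ Finset.range n, ∫ ω, δ k (fun i => X i ω) (X k ω) ^ 2 ∂P) / ε ^ 2 := by
  set D : ℕ → Ω → ℝ := fun k ω => δ k (fun i => X i ω) (X k ω) with hD
  set Z : ℕ → Ω → ℝ := fun n ω => ∑ k ∈ Finset.range n, D k ω with hZ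
  set 𝒢 := pastFiltration X hmeas with h𝒢
  have hZm : ∀ n, Measurable[𝒢 n] (Z n) := measurable_pastFiltration_sum hmeas hδ
  have hZL : ∀ n, MemLp (Z n) 2 P := fun n => memLp_finsetSum _ fun k _ => hL2 k
  have hsucc : ∀ k ω, Z (k + 1) ω = Z k ω + D k ω := fun k ω => Finset.sum_range_succ _ _
  have hZD : ∀ k, Integrable (fun ω => Z k ω * D k ω) P := fun k =>
    (hZL k).integrable_mul (hL2 k)
  have hstep : ∀ k (s : Set Ω), MeasurableSet[𝒢 k] s →
      ∫ ω in s, Z (k + 1) ω ^ 2 ∂P = ∫ ω in s, Z k ω ^ 2 ∂P + ∫ ω in s, D k ω ^ 2 ∂P := by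
    intro k s hs
    have hcross : ∫ ω in s, Z k ω * D k ω ∂P = 0 := by
      rw [← integral_indicator (𝒢.le k s hs)]
      have h := integral_mul_innovation_eq_zero hmeas hindep hlaw (hδ k) (h0 k)
        (W := s.indicator (Z k)) ((hZm k).indicator hs)
      rw [← h]
      refine integral_congr_ae (ae_of_all _ fun ω => ?_)
      by_cases hω : ω ∈ s <;> simp [hω, hD]
    have hexp : ∀ ω, Z (k + 1) ω ^ 2 = Z k ω ^ 2 + 2 * (Z k ω * D k ω) + D k ω ^ 2 := fun ω => by
      rw [hsucc]; ring
    simp_rw [hexp]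
    have i1 := ((hZL k).integrable_sq).restrict (s := s)
    have i2 := ((hZD k).const_mul 2).restrict (s := s)
    have i3 := ((hL2 k).integrable_sq).restrict (s := s)
    have e1 := integral_add (f := fun ω => Z k ω ^ 2 + 2 * (Z k ω * D k ω))
      (g := fun ω => D k ω ^ 2) (i1.add i2) i3
    rw [e1, integral_add i1 i2, integral_const_mul, hcross]
    ring
  have hsub : Submartingale (fun n ω => Z n ω ^ 2) 𝒢 P := by
    refine submartingale_of_setIntegral_le_succ
      (fun n => ((hZm n).pow_const 2).stronglyMeasurable) (fun n => (hZL n).integrable_sq)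
      fun k s hs => ?_
    rw [hstep k s hs]
    exact le_add_of_nonneg_right (integral_nonneg fun ω => sq_nonneg _)
  have hvar : ∀ n, ∫ ω, Z n ω ^ 2 ∂P = ∑ k ∈ Finset.range n, ∫ ω, D k ω ^ 2 ∂P := by
    intro n
    induction n with
    | zero => simp [hZ]
    | succ n ih =>
      have := hstep n Set.univ MeasurableSet.univ
      simp only [Measure.restrict_univ] at this
      rw [this, ih, Finset.sum_range_succ]
  rw [← hvar]
  obtain ⟨e, he⟩ : ∃ e : NNReal, (e : ℝ) = ε ^ 2 := ⟨_, Real.coe_toNNReal _ (sq_nonneg ε)⟩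
  have hmax := maximal_ineq hsub (fun n ω => sq_nonneg _) (ε := e) n
  have hset : {ω | ∃ k ≤ n, ε ≤ |Z k ω|}
      = {ω | (e : ℝ) ≤
        (Finset.range (n + 1)).sup' Finset.nonempty_range_add_one fun k => Z k ω ^ 2} := by
    ext ω
    simp only [Set.mem_ofPred_eq, Finset.le_sup'_iff, Finset.mem_range, Nat.lt_succ_iff, he]
    refine exists_congr fun k => and_congr_right fun _ => ?_
    rw [← sq_abs (Z k ω)]
    exact (pow_le_pow_iff_left₀ hε.le (abs_nonneg _) two_ne_zero).symm
  rw [← hset] at hmax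
  have h2 := ENNReal.toReal_mono ENNReal.ofReal_ne_top hmax
  rw [ENNReal.toReal_mul, ENNReal.coe_toReal, he,
    ENNReal.toReal_ofReal (integral_nonneg fun ω => sq_nonneg _)] at h2
  have h3 : ∫ ω in {ω | ∃ k ≤ n, ε ≤ |Z k ω|}, Z n ω ^ 2 ∂P ≤ ∫ ω, Z n ω ^ 2 ∂P :=
    setIntegral_le_integral (hZL n).integrable_sq (ae_of_all _ fun ω => sq_nonneg _)
  rw [le_div_iff₀ (by positivity), mul_comm]
  exact h2.trans h3

end Maximal

/-! ### Oscillation of sums of i.i.d. variables -/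

section Oscillation

variable {Ω : Type*} [MeasurableSpace Ω] {P : Measure Ω} {F : Measure ℝ} {X : ℕ → Ω → ℝ}

lemma memLp_comp (hmeas : ∀ i, Measurable (X i)) (hlaw : ∀ i, P.map (X i) = F) {ψ : ℝ → ℝ}
    (hψ : MemLp ψ 2 F) (i : ℕ) : MemLp (fun ω => ψ (X i ω)) 2 P := by
  have h : MemLp ψ 2 (P.map (X i)) := by rwa [hlaw i]
  exact h.comp_of_map (hmeas i).aemeasurable

lemma integral_comp_law (hmeas : ∀ i, Measurable (X i)) (hlaw : ∀ i, P.map (X i) = F) {f : ℝ → ℝ}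
    (hf : Measurable f) (i : ℕ) : ∫ ω, f (X i ω) ∂P = ∫ x, f x ∂F := by
  rw [← hlaw i, integral_map (hmeas i).aemeasurable hf.aestronglyMeasurable]

variable [IsProbabilityMeasure P] [IsProbabilityMeasure F]

lemma measureReal_oscillation_le (hmeas : ∀ i, Measurable (X i)) (hindep : iIndepFun X P)
    (hlaw : ∀ i, P.map (X i) = F) {ψ : ℝ → ℝ} (hψm : Measurable ψ) (hψ : MemLp ψ 2 F)
    (h0 : ∫ x, ψ x ∂F = 0) {ε : ℝ} (hε : 0 < ε) (a l : ℕ) :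
    P.real {ω | ∃ k ≤ l, ε ≤ |∑ i ∈ Finset.range (a + k), ψ (X i ω)
        - ∑ i ∈ Finset.range a, ψ (X i ω)|} ≤ l * (∫ x, ψ x ^ 2 ∂F) / ε ^ 2 := by
  have h := measureReal_exists_le_abs_sum_le (X := fun k => X (a + k)) (δ := fun _ _ u => ψ u)
    (fun i => hmeas _) (hindep.precomp (add_right_injective a)) (fun i => hlaw _)
    (fun k => hψm.comp measurable_snd) (fun _ _ => h0) (fun k => memLp_comp hmeas hlaw hψ _) hε l
  simp only [integral_comp_law hmeas hlaw (hψm.pow_const 2), Finset.sum_const, Finset.card_range,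
    nsmul_eq_mul] at h
  convert h using 9
  rw [Finset.sum_range_add]
  ring

/-- Anscombe's condition: sums of i.i.d. centred square-integrable variables oscillate little, at
the scale `√m`, over indices in a short relative window around `m`. -/
lemma exists_window_sum (hmeas : ∀ i, Measurable (X i)) (hindep : iIndepFun X P)
    (hlaw : ∀ i, P.map (X i) = F) {ψ : ℝ → ℝ} (hψm : Measurable ψ) (hψ : MemLp ψ 2 F)
    (h0 : ∫ x, ψ x ∂F = 0) {ε η : ℝ} (hε : 0 < ε) (hη : 0 < η) :
    ∃ δ : ℝ, 0 < δ ∧ δ ≤ 1 / 2 ∧ ∀ m : ℕ, 0 < m →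
      P.real {ω | ∃ n : ℕ, |(n : ℝ) - m| ≤ δ * m ∧ ε * √m <
        |∑ i ∈ Finset.range n, ψ (X i ω) - ∑ i ∈ Finset.range m, ψ (X i ω)|} ≤ η := by
  set v := ∫ x, ψ x ^ 2 ∂F
  have hv : 0 ≤ v := integral_nonneg fun _ => sq_nonneg _
  -- `8 v δ / ε ^ 2` bounds the probability; the `+ 1` covers `v = 0`
  refine ⟨min (1 / 2) (η * ε ^ 2 / (8 * v + 1)), by positivity, min_le_left _ _, fun m hm => ?_⟩
  set δ := min (1 / 2) (η * ε ^ 2 / (8 * v + 1))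
  have hm' : (0 : ℝ) < m := by exact_mod_cast hm
  have hδ0 : 0 < δ := by positivity
  have hδ1 : δ ≤ 1 / 2 := min_le_left _ _
  set w := ⌊δ * m⌋₊
  have hw : (w : ℝ) ≤ δ * m := Nat.floor_le (by positivity)
  have hwm : w ≤ m := by
    have : (w : ℝ) ≤ m := by nlinarith
    exact_mod_cast this
  have hs : 0 < √(m : ℝ) := Real.sqrt_pos.2 hm'
  have hε' : 0 < ε * √m / 2 := by positivity
  have h := measureReal_oscillation_le hmeas hindep hlaw hψm hψ h0 hε' (m - w) (2 * w)
  refine (measureReal_mono ?_).trans (h.trans ?_)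
  · rintro ω ⟨n, hn, hlt⟩
    have hnw : n ≤ m + w ∧ m ≤ n + w := by
      rw [abs_le] at hn
      constructor
      · by_contra! hc
        have h1 : w + 1 ≤ n - m := by omega
        have h2 : δ * m < w + 1 := Nat.lt_floor_add_one _
        have h3 : ((m + w + 1 : ℕ) : ℝ) ≤ n := by exact_mod_cast hc
        push_cast at h3
        linarith [hn.2]
      · by_contra! hc
        have h2 : δ * m < w + 1 := Nat.lt_floor_add_one _
        have h3 : ((n + w + 1 : ℕ) : ℝ) ≤ m := by exact_mod_cast hc
        push_cast at h3
        linarith [hn.1]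
    by_contra! hc
    simp only [Set.mem_ofPred_eq, not_exists, not_and, not_le] at hc
    have h1 := hc (n - (m - w)) (by omega)
    have h2 := hc w (by omega)
    rw [show m - w + (n - (m - w)) = n by omega] at h1
    rw [show m - w + w = m by omega] at h2
    have h3 := abs_sub_le (∑ i ∈ Finset.range n, ψ (X i ω))
      (∑ i ∈ Finset.range (m - w), ψ (X i ω)) (∑ i ∈ Finset.range m, ψ (X i ω))
    rw [abs_sub_comm (∑ i ∈ Finset.range (m - w), ψ (X i ω))] at h3
    linarith
  · have hδ2 : δ ≤ η * ε ^ 2 / (8 * v + 1) := min_le_right _ _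
    rw [le_div_iff₀ (by positivity)] at hδ2
    rw [div_le_iff₀ (by positivity), div_pow, mul_pow, Real.sq_sqrt hm'.le]
    push_cast
    have h1 : (w : ℝ) * v ≤ δ * m * v := by gcongr
    have h2 : δ * (8 * v) ≤ η * ε ^ 2 := by nlinarith
    nlinarith

/-! ### The degenerate part of the mean difference -/

/-- The degenerate kernel `|x - y| - g x - g y + Δ` of the Hoeffding decomposition of Gini's mean
difference: its integral over either variable vanishes. -/
noncomputable def degKernel (F : Measure ℝ) (x y : ℝ) : ℝ :=
  |x - y| - meanDist F x - meanDist F y + popMeanDiff F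

lemma degKernel_comm (F : Measure ℝ) (x y : ℝ) : degKernel F x y = degKernel F y x := by
  rw [degKernel, degKernel, abs_sub_comm]; ring

lemma integral_degKernel (hF : MemLp (fun x : ℝ => x) 2 F) (x : ℝ) :
    ∫ y, degKernel F x y ∂F = 0 := by
  have hF1 := hF.integrable (by norm_num)
  have hg := (memLp_meanDist hF).integrable (by norm_num)
  have i1 := (integrable_abs_sub hF1 x).sub (integrable_const (meanDist F x))
  have e1 := integral_add (f := fun y => |x - y| - meanDist F x - meanDist F y)
    (g := fun _ => popMeanDiff F) (i1.sub hg) (integrable_const _)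
  have e2 := integral_sub (f := fun y => |x - y| - meanDist F x) i1 hg
  have e3 := integral_sub (integrable_abs_sub hF1 x) (integrable_const (meanDist F x))
  simp only [degKernel]
  rw [e1, e2, e3, ← popMeanDiff_eq hF1]
  simp [meanDist]

lemma continuous_degKernel (hF : Integrable (fun x : ℝ => x) F) :
    Continuous (Function.uncurry (degKernel F)) := by
  have h := continuous_meanDist hF
  have h1 : Continuous fun p : ℝ × ℝ => |p.1 - p.2| - meanDist F p.1 - meanDist F p.2
      + popMeanDiff F :=
    (((continuous_fst.sub continuous_snd).abs.sub (h.comp continuous_fst)).sub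
      (h.comp continuous_snd)).add continuous_const
  exact h1

lemma memLp_degKernel_comp (hmeas : ∀ i, Measurable (X i)) (hlaw : ∀ i, P.map (X i) = F)
    (hF : MemLp (fun x : ℝ => x) 2 F) (i j : ℕ) :
    MemLp (fun ω => degKernel F (X i ω) (X j ω)) 2 P :=
  ((((memLp_comp hmeas hlaw hF i).sub (memLp_comp hmeas hlaw hF j)).abs.sub
    (memLp_comp hmeas hlaw (memLp_meanDist hF) i)).sub
    (memLp_comp hmeas hlaw (memLp_meanDist hF) j)).add (memLp_const _)

lemma integral_degKernel_sq (hmeas : ∀ i, Measurable (X i)) (hindep : iIndepFun X P)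
    (hlaw : ∀ i, P.map (X i) = F) (hF : MemLp (fun x : ℝ => x) 2 F) {i j : ℕ} (hij : i ≠ j) :
    ∫ ω, degKernel F (X i ω) (X j ω) ^ 2 ∂P
      = ∫ p, Function.uncurry (degKernel F) p ^ 2 ∂(F.prod F) := by
  have h := (hindep.indepFun hij).map_prod_eq_prod_map_map (hmeas i).aemeasurable
    (hmeas j).aemeasurable
  rw [hlaw, hlaw] at h
  rw [← h, integral_map ((hmeas i).prodMk (hmeas j)).aemeasurable
    (f := fun p => Function.uncurry (degKernel F) p ^ 2)
    ((continuous_degKernel (hF.integrable (by norm_num))).pow 2).aestronglyMeasurable]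
  rfl

lemma integral_degKernel_mul (hmeas : ∀ i, Measurable (X i)) (hindep : iIndepFun X P)
    (hlaw : ∀ i, P.map (X i) = F) (hF : MemLp (fun x : ℝ => x) 2 F) {i k j : ℕ} (hik : i ≠ k)
    (hij : i ≠ j) :
    ∫ ω, degKernel F (X i ω) (X j ω) * degKernel F (X k ω) (X j ω) ∂P = 0 := by
  have hm := (continuous_degKernel (hF.integrable (by norm_num))).measurable
  set T : Finset ℕ := {k, j} with hT
  obtain ⟨k', hk'⟩ : ∃ k' : T, (k' : ℕ) = k := ⟨⟨k, by simp [hT]⟩, rfl⟩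
  obtain ⟨j', hj'⟩ : ∃ j' : T, (j' : ℕ) = j := ⟨⟨j, by simp [hT]⟩, rfl⟩
  have hjm : Measurable fun p : (T → ℝ) × ℝ => p.1 j' :=
    (measurable_pi_apply j').comp measurable_fst
  have hkm : Measurable fun p : (T → ℝ) × ℝ => p.1 k' :=
    (measurable_pi_apply k').comp measurable_fst
  have h1 : Measurable fun p : (T → ℝ) × ℝ => degKernel F p.2 (p.1 j') :=
    hm.comp (measurable_snd.prodMk hjm)
  have h2 : Measurable fun p : (T → ℝ) × ℝ => degKernel F (p.1 k') (p.1 j') :=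
    hm.comp (hkm.prodMk hjm)
  have h := integral_comp_eq_zero_of_notMem (T := T) (a := i)
    (φ := fun v u => degKernel F u (v j') * degKernel F (v k') (v j'))
    hmeas hindep hlaw (by simp [hT, hik, hij]) (h1.mul h2) fun v => by
      simp_rw [degKernel_comm F _ (v j')]
      rw [integral_mul_const, integral_degKernel hF, zero_mul]
  simpa only [hk', hj'] using h

lemma integral_sum_degKernel_sq (hmeas : ∀ i, Measurable (X i)) (hindep : iIndepFun X P)
    (hlaw : ∀ i, P.map (X i) = F) (hF : MemLp (fun x : ℝ => x) 2 F) (j : ℕ) :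
    ∫ ω, (∑ i ∈ Finset.range j, degKernel F (X i ω) (X j ω)) ^ 2 ∂P
      = j * ∫ p, Function.uncurry (degKernel F) p ^ 2 ∂(F.prod F) := by
  have hL := memLp_degKernel_comp hmeas hlaw hF
  have hint : ∀ i k, Integrable
      (fun ω => degKernel F (X i ω) (X j ω) * degKernel F (X k ω) (X j ω)) P :=
    fun i k => (hL i j).integrable_mul (hL k j)
  simp_rw [sq (∑ i ∈ Finset.range j, _), Finset.sum_mul_sum]
  rw [integral_finsetSum _ fun i _ => integrable_finsetSum _ fun k _ => hint i k]
  have : ∀ i ∈ Finset.range j, ∫ ω, ∑ k ∈ Finset.range j,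
      degKernel F (X i ω) (X j ω) * degKernel F (X k ω) (X j ω) ∂P
      = ∫ p, Function.uncurry (degKernel F) p ^ 2 ∂(F.prod F) := by
    intro i hi
    have hij : i ≠ j := (Finset.mem_range.1 hi).ne
    rw [integral_finsetSum _ fun k _ => hint i k, Finset.sum_eq_single i
      (fun k _ hk => integral_degKernel_mul hmeas hindep hlaw hF hk.symm hij)
      (fun h => absurd hi h), ← integral_degKernel_sq hmeas hindep hlaw hF hij]
    simp_rw [sq]
  rw [Finset.sum_congr rfl this]
  simp

lemma measureReal_exists_le_abs_sum_degKernel_le (hmeas : ∀ i, Measurable (X i))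
    (hindep : iIndepFun X P) (hlaw : ∀ i, P.map (X i) = F) (hF : MemLp (fun x : ℝ => x) 2 F)
    {ε : ℝ} (hε : 0 < ε) (n : ℕ) :
    P.real {ω | ∃ k ≤ n, ε ≤ |∑ j ∈ Finset.range k, ∑ i ∈ Finset.range j,
        degKernel F (X i ω) (X j ω)|}
      ≤ n ^ 2 * (∫ p, Function.uncurry (degKernel F) p ^ 2 ∂(F.prod F)) / ε ^ 2 := by
  have hF1 := hF.integrable (by norm_num)
  have hm := (continuous_degKernel hF1).measurable
  set c := ∫ p, Function.uncurry (degKernel F) p ^ 2 ∂(F.prod F)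
  have hc : 0 ≤ c := integral_nonneg fun _ => sq_nonneg _
  have hsum : ∀ ω k, ∑ i : Finset.range k, degKernel F (X i ω) (X k ω)
      = ∑ i ∈ Finset.range k, degKernel F (X i ω) (X k ω) := fun ω k =>
    Finset.sum_coe_sort (Finset.range k) fun i => degKernel F (X i ω) (X k ω)
  have h := measureReal_exists_le_abs_sum_le (F := F)
    (δ := fun k v u => ∑ i : Finset.range k, degKernel F (v i) u) hmeas hindep hlaw ?_ ?_ ?_ hε n
  · simp_rw [hsum, integral_sum_degKernel_sq hmeas hindep hlaw hF] at h
    refine h.trans ?_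
    rw [← Finset.sum_mul, sq (n : ℝ)]
    have h2 : ∑ k ∈ Finset.range n, (k : ℝ) ≤ n * n := by
      calc ∑ k ∈ Finset.range n, (k : ℝ) ≤ ∑ k ∈ Finset.range n, (n : ℝ) :=
            Finset.sum_le_sum fun k hk => by exact_mod_cast (Finset.mem_range.1 hk).le
        _ = n * n := by simp
    gcongr
  · intro k
    refine Finset.measurable_fun_sum _ fun i _ => ?_
    have hi : Measurable fun p : (Finset.range k → ℝ) × ℝ => p.1 i :=
      (measurable_pi_apply i).comp measurable_fst
    exact hm.comp (hi.prodMk measurable_snd)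
  · intro k v
    rw [integral_finsetSum _ fun i _ => ?_]
    · simp [integral_degKernel hF]
    · exact (((integrable_abs_sub hF1 _).sub (integrable_const _)).sub
        ((memLp_meanDist hF).integrable (by norm_num))).add (integrable_const _)
  · intro k
    simp_rw [hsum]
    exact memLp_finsetSum _ fun i _ => memLp_degKernel_comp hmeas hlaw hF i k

/-- The remainder `n (Δ̂ₙ - Δ) - 2 ∑ (g (x i) - Δ)` of the linearisation of Gini's mean
difference. -/
noncomputable def meanDiffRem (F : Measure ℝ) (x : ℕ → ℝ) (n : ℕ) : ℝ :=
  n * (sampleMeanDiff x n - popMeanDiff F)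
    - 2 * ∑ i ∈ Finset.range n, (meanDist F (x i) - popMeanDiff F)

lemma sum_sum_range_add (a : ℕ → ℝ) (n : ℕ) :
    ∑ j ∈ Finset.range n, ∑ i ∈ Finset.range j, (a i + a j)
      = ((n : ℝ) - 1) * ∑ i ∈ Finset.range n, a i := by
  induction n with
  | zero => simp
  | succ n ih =>
    rw [Finset.sum_range_succ, ih, Finset.sum_add_distrib, Finset.sum_range_succ]
    simp only [Finset.sum_const, Finset.card_range, nsmul_eq_mul]
    push_cast
    ring

lemma meanDiffRem_eq (F : Measure ℝ) (x : ℕ → ℝ) {n : ℕ} (hn : 2 ≤ n) :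
    meanDiffRem F x n = 2 / ((n : ℝ) - 1) *
      ∑ j ∈ Finset.range n, ∑ i ∈ Finset.range j, degKernel F (x i) (x j) := by
  have hn' : (2 : ℝ) ≤ n := by exact_mod_cast hn
  have h1 : (n : ℝ) - 1 ≠ 0 := by linarith
  have h2 : (n : ℝ) ≠ 0 := by linarith
  set a : ℕ → ℝ := fun i => meanDist F (x i) - popMeanDiff F / 2 with ha
  have hk : ∀ i j, degKernel F (x i) (x j) = |x i - x j| - (a i + a j) := fun i j => by
    simp only [degKernel, ha]; ring
  simp_rw [hk, Finset.sum_sub_distrib]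
  rw [sum_sum_range_add, ← sum_pairs (fun i j => |x i - x j|), meanDiffRem, sampleMeanDiff,
    Nat.cast_choose_two, Finset.sum_sub_distrib, ha, Finset.sum_sub_distrib]
  simp only [Finset.sum_const, Finset.card_range, nsmul_eq_mul]
  field_simp
  ring

/-- The degenerate part is negligible, at the scale `√m`, uniformly over indices between `m / 2`
and `3 m / 2`. -/
lemma eventually_window_meanDiffRem (hmeas : ∀ i, Measurable (X i)) (hindep : iIndepFun X P)
    (hlaw : ∀ i, P.map (X i) = F) (hF : MemLp (fun x : ℝ => x) 2 F) {ε η : ℝ} (hε : 0 < ε)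
    (hη : 0 < η) :
    ∀ᶠ m : ℕ in atTop, P.real {ω | ∃ n : ℕ, |(n : ℝ) - m| ≤ m / 2 ∧
      ε * √m < |meanDiffRem F (fun i => X i ω) n|} ≤ η := by
  set c := ∫ p, Function.uncurry (degKernel F) p ^ 2 ∂(F.prod F) with hc
  have hc0 : 0 ≤ c := integral_nonneg fun _ => sq_nonneg _
  filter_upwards [eventually_ge_atTop 4,
    tendsto_natCast_atTop_atTop.eventually_ge_atTop (256 * c / (ε ^ 2 * η))] with m hm hmc
  have hm' : (4 : ℝ) ≤ m := by exact_mod_cast hm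
  have hs : 0 < √(m : ℝ) := Real.sqrt_pos.2 (by linarith)
  have hε' : 0 < ε * √m * m / 8 := by positivity
  have h := measureReal_exists_le_abs_sum_degKernel_le hmeas hindep hlaw hF hε' (2 * m)
  rw [← hc] at h
  refine (measureReal_mono ?_).trans (h.trans ?_)
  · rintro ω ⟨n, hn, hlt⟩
    rw [abs_le] at hn
    have hn1 : (2 : ℝ) ≤ n := by linarith [hn.1]
    have hn2 : 2 ≤ n := by exact_mod_cast hn1
    have hn3 : (n : ℝ) ≤ ((2 * m : ℕ) : ℝ) := by push_cast; linarith [hn.2]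
    refine ⟨n, by exact_mod_cast hn3, ?_⟩
    rw [meanDiffRem_eq F _ hn2, abs_mul, abs_of_pos (div_pos two_pos (by linarith)),
      div_mul_eq_mul_div, lt_div_iff₀ (by linarith)] at hlt
    have h4 : (m : ℝ) / 4 ≤ (n : ℝ) - 1 := by linarith [hn.1]
    have h5 : ε * √m * (m / 4) ≤ ε * √m * ((n : ℝ) - 1) := by gcongr
    linarith
  · rw [div_le_iff₀ (by positivity)] at hmc
    rw [div_le_iff₀ (by positivity), div_pow, mul_pow, mul_pow, Real.sq_sqrt (by linarith)]
    push_cast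
    have h6 : 256 * c * (m : ℝ) ^ 2 ≤ m * (ε ^ 2 * η) * (m : ℝ) ^ 2 := by gcongr
    nlinarith

end Oscillation

/-! ### Almost sure typicality of i.i.d. sequences -/

section Typical

variable {Ω : Type*} [MeasurableSpace Ω] {P : Measure Ω} {F : Measure ℝ} {X : ℕ → Ω → ℝ}

lemma ae_tendsto_average (hmeas : ∀ i, Measurable (X i)) (hindep : iIndepFun X P)
    (hlaw : ∀ i, P.map (X i) = F) {f : ℝ → ℝ} (hf : Measurable f) (hint : Integrable f F) :
    ∀ᵐ ω ∂P, Tendsto (fun n : ℕ => (∑ i ∈ Finset.range n, f (X i ω)) / n) atTop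
      (𝓝 (∫ x, f x ∂F)) := by
  have hid : ∀ i, IdentDistrib (fun ω => f (X i ω)) (fun ω => f (X 0 ω)) P P := fun i =>
    IdentDistrib.comp ⟨(hmeas i).aemeasurable, (hmeas 0).aemeasurable, by rw [hlaw, hlaw]⟩ hf
  have hi : Integrable (fun ω => f (X 0 ω)) P := by
    have : Integrable f (P.map (X 0)) := by rwa [hlaw]
    exact this.comp_measurable (hmeas 0)
  have h := strong_law_ae_real (fun i ω => f (X i ω)) hi
    (fun i j hij => (hindep.indepFun hij).comp hf hf) hid
  rwa [integral_comp_law hmeas hlaw hf 0] at h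

variable [IsProbabilityMeasure F]

theorem ae_isTypical (hmeas : ∀ i, Measurable (X i)) (hindep : iIndepFun X P)
    (hlaw : ∀ i, P.map (X i) = F) (hnonneg : ∀ᵐ x ∂F, 0 ≤ x) (hF : MemLp (fun x : ℝ => x) 2 F) :
    ∀ᵐ ω ∂P, IsTypical F fun i => X i ω := by
  have hF1 := hF.integrable (by norm_num)
  have hg := memLp_meanDist hF
  have hgm := (continuous_meanDist hF1).measurable
  have hn : ∀ᵐ ω ∂P, ∀ i, 0 ≤ X i ω := ae_all_iff.2 fun i =>
    ae_of_ae_map (hmeas i).aemeasurable (by rwa [hlaw i])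
  have hq : ∀ᵐ ω ∂P, ∀ q : ℚ, Tendsto (fun n => empDist (fun i => X i ω) n q) atTop
      (𝓝 (meanDist F q)) := ae_all_iff.2 fun q =>
    ae_tendsto_average hmeas hindep hlaw (f := fun y => |(q : ℝ) - y|) (by fun_prop)
      (integrable_abs_sub hF1 q)
  filter_upwards [hn, hq, ae_tendsto_average hmeas hindep hlaw measurable_id hF1,
    ae_tendsto_average hmeas hindep hlaw (measurable_id.pow_const 2) hF.integrable_sq,
    ae_tendsto_average hmeas hindep hlaw hgm (hg.integrable (by norm_num)),
    ae_tendsto_average hmeas hindep hlaw (measurable_id.mul hgm) (hF.integrable_mul hg),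
    ae_tendsto_average hmeas hindep hlaw (hgm.pow_const 2) hg.integrable_sq]
    with ω h1 h2 h3 h4 h5 h6 h7
  exact ⟨h1, h3, h4, h5, h6, h7, h2⟩

end Typical

lemma measurable_sampleMean (n : ℕ) : Measurable fun x : ℕ → ℝ => sampleMean x n := by
  unfold sampleMean
  fun_prop

lemma measurable_varEst (n : ℕ) : Measurable fun x : ℕ → ℝ => varEst x n := by
  unfold varEst pseudoVar pseudoValue deletedMeanDiff sampleVar sampleTau sampleMeanDiff sampleMean
  fun_prop

/-- If an event sequence holds eventually almost surely, then it holds from some index `K` on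
outside an event of small probability. -/
lemma exists_measureReal_not_forall_le {Ω : Type*} [MeasurableSpace Ω] {P : Measure Ω}
    [IsProbabilityMeasure P] {p : ℕ → Ω → Prop} (hp : ∀ n, MeasurableSet {ω | p n ω})
    (h : ∀ᵐ ω ∂P, ∀ᶠ n in atTop, p n ω) {η : ℝ} (hη : 0 < η) :
    ∃ K : ℕ, P.real {ω | ¬ ∀ n, K ≤ n → p n ω} ≤ η := by
  set A : ℕ → Set Ω := fun K => {ω | ¬ ∀ n, K ≤ n → p n ω} with hA
  have hAm : ∀ K, MeasurableSet (A K) := fun K => by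
    have : A K = (⋂ n, ⋂ (_ : K ≤ n), {ω | p n ω})ᶜ := by
      ext ω; simp [hA]
    rw [this]
    exact (MeasurableSet.iInter fun n => MeasurableSet.iInter fun _ => hp n).compl
  have hanti : Antitone A := fun K L hKL ω hω hc => hω fun n hn => hc n (hKL.trans hn)
  have hzero : P (⋂ K, A K) = 0 := by
    refine measure_mono_null ?_ (ae_iff.1 h)
    intro ω hω hc
    obtain ⟨K, hK⟩ := eventually_atTop.1 hc
    exact Set.mem_iInter.1 hω K hK
  have ht := tendsto_measure_iInter_atTop (μ := P) (fun K => (hAm K).nullMeasurableSet) hanti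
    ⟨0, measure_ne_top _ _⟩
  rw [hzero] at ht
  have ht' := (ENNReal.tendsto_toReal ENNReal.zero_ne_top).comp ht
  obtain ⟨K, hK⟩ := (ht'.eventually_le_const (show (0 : ENNReal).toReal < η by simpa)).exists
  exact ⟨K, hK⟩

/-! ### The linearised Gini index -/

/-- The influence function `2 μ (g x - Δ) - Δ (x - μ)` of the linearisation of
`2 μ X̄ₙ (Ĝₙ - G)`. -/
noncomputable def linKernel (F : Measure ℝ) (x : ℝ) : ℝ :=
  2 * popMean F * (meanDist F x - popMeanDiff F) - popMeanDiff F * (x - popMean F)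

lemma sampleGini_sub_giniIndex {F : Measure ℝ} (hμ : 0 < popMean F) {x : ℕ → ℝ} {n : ℕ}
    (hn : 0 < n) (hx : 0 < sampleMean x n) :
    sampleGini x n - giniIndex F = (∑ i ∈ Finset.range n, linKernel F (x i)
      + popMean F * meanDiffRem F x n) / (2 * popMean F * sampleMean x n * n) := by
  have hn' : (n : ℝ) ≠ 0 := by exact_mod_cast hn.ne'
  have hs : ∑ i ∈ Finset.range n, x i = n * sampleMean x n := by
    rw [sampleMean]; field_simp
  simp only [linKernel, meanDiffRem, Finset.sum_sub_distrib, ← Finset.mul_sum, hs]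
  simp only [Finset.sum_const, Finset.card_range, nsmul_eq_mul]
  rw [sampleGini, giniIndex]
  field_simp
  ring

section LinKernel

variable {F : Measure ℝ} [IsProbabilityMeasure F]

lemma memLp_linKernel (hF : MemLp (fun x : ℝ => x) 2 F) : MemLp (linKernel F) 2 F :=
  (((memLp_meanDist hF).sub (memLp_const _)).const_mul _).sub ((hF.sub (memLp_const _)).const_mul _)

lemma continuous_linKernel (hF : Integrable (fun x : ℝ => x) F) : Continuous (linKernel F) := by
  have := continuous_meanDist hF
  unfold linKernel
  fun_prop

lemma integral_linKernel (hF : MemLp (fun x : ℝ => x) 2 F) : ∫ x, linKernel F x ∂F = 0 := by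
  have hF1 := hF.integrable (by norm_num)
  have hg := (memLp_meanDist hF).integrable (by norm_num)
  simp only [linKernel]
  have e := integral_sub
    (f := fun x => 2 * popMean F * (meanDist F x - popMeanDiff F))
    (g := fun x => popMeanDiff F * (x - popMean F))
    ((hg.sub (integrable_const _)).const_mul _) ((hF1.sub (integrable_const _)).const_mul _)
  rw [e, integral_const_mul, integral_const_mul, integral_sub hg (integrable_const _),
    integral_sub hF1 (integrable_const _), ← popMeanDiff_eq hF1]
  simp [popMean]

/-- The variance of the influence function is `4 μ⁴ ξ²`. -/
lemma integral_linKernel_sq (hF : MemLp (fun x : ℝ => x) 2 F) (hμ : 0 < popMean F) :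
    ∫ x, linKernel F x ^ 2 ∂F = 4 * popMean F ^ 4 * asympVar F := by
  have hF1 := hF.integrable (by norm_num)
  have hgL := memLp_meanDist hF
  have hg := hgL.integrable (by norm_num)
  set μ := popMean F with hμd
  set Δ := popMeanDiff F with hΔd
  -- `linKernel F x = 2 μ g(x) - Δ x + c`, with `c` collecting the constants
  set c := μ * Δ - 2 * μ * Δ with hc
  have hexp : ∀ x, linKernel F x ^ 2 = (4 * μ ^ 2) * meanDist F x ^ 2
      + (-(4 * μ * Δ)) * (x * meanDist F x) + Δ ^ 2 * x ^ 2
      + (4 * μ * c) * meanDist F x + (-(2 * Δ * c)) * x + c ^ 2 := fun x => by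
    rw [linKernel, hc]; ring
  simp_rw [hexp]
  have i1 := hgL.integrable_sq.const_mul (4 * μ ^ 2)
  have i2 := (hF.integrable_mul hgL).const_mul (-(4 * μ * Δ))
  have i3 := hF.integrable_sq.const_mul (Δ ^ 2)
  have i4 := hg.const_mul (4 * μ * c)
  have i5 := hF1.const_mul (-(2 * Δ * c))
  have i6 := integrable_const (μ := F) (c ^ 2)
  have e5 := integral_add ((((i1.add i2).add i3).add i4).add i5) i6
  have e4 := integral_add (((i1.add i2).add i3).add i4) i5
  have e3 := integral_add ((i1.add i2).add i3) i4
  have e2 := integral_add (i1.add i2) i3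
  have e1 := integral_add i1 i2
  simp only [Pi.add_apply, Pi.mul_apply] at e1 e2 e3 e4 e5
  rw [e5, e4, e3, e2, e1]
  rw [integral_const_mul _ fun x : ℝ => x]
  simp only [integral_const_mul]
  have hA := projVar_eq hF
  have hB := popTau_eq hF
  have hC := popVar_eq hF
  have hD := popMeanDiff_eq hF1
  have hM : ∫ x, x ∂F = μ := rfl
  rw [← hB, ← hD, hM, show ∫ x, meanDist F x ^ 2 ∂F = projVar F + Δ ^ 2 by rw [hA]; ring,
    show ∫ x, x ^ 2 ∂F = popVar F + μ ^ 2 by rw [hC]; ring, asympVar, ← hμd, ← hΔd, hc]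
  simp only [integral_const, probReal_univ, smul_eq_mul, one_mul]
  field_simp
  ring

end LinKernel

/-- The fixed-width interval covers the Gini index if and only if the standardised linear
statistic, corrected by the degenerate remainder, is below an explicit threshold. -/
lemma abs_sampleGini_sub_lt_iff {F : Measure ℝ} (hμ : 0 < popMean F) {ξ : ℝ} (hξ : 0 < ξ)
    {x : ℕ → ℝ} {n : ℕ} (hn : 0 < n) (hx : 0 < sampleMean x n) {d : ℝ} :
    (sampleGini x n - d < giniIndex F ∧ giniIndex F < sampleGini x n + d) ↔
      |∑ i ∈ Finset.range n, linKernel F (x i) / (2 * popMean F ^ 2 * ξ)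
        + popMean F / (2 * popMean F ^ 2 * ξ) * meanDiffRem F x n|
        < sampleMean x n / popMean F * (d * n / ξ) := by
  have hn' : (0 : ℝ) < n := by exact_mod_cast hn
  have h1 : (sampleGini x n - d < giniIndex F ∧ giniIndex F < sampleGini x n + d) ↔
      |sampleGini x n - giniIndex F| < d := by
    rw [abs_lt]
    constructor <;> rintro ⟨h, h'⟩ <;> constructor <;> linarith
  rw [h1, sampleGini_sub_giniIndex hμ hn hx, ← Finset.sum_div, div_mul_eq_mul_div, ← add_div,
    abs_div, abs_div, abs_of_pos (show 0 < 2 * popMean F * sampleMean x n * n by positivity),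
    abs_of_pos (show 0 < 2 * popMean F ^ 2 * ξ by positivity), div_lt_iff₀ (by positivity),
    div_lt_iff₀ (by positivity)]
  have : d * (2 * popMean F * sampleMean x n * n)
      = sampleMean x n / popMean F * (d * n / ξ) * (2 * popMean F ^ 2 * ξ) := by
    field_simp
  rw [this]

/-! ### Asymptotic coverage -/

/-- Convergence of probabilities by sandwiching: up to events of small probability, `E d` lies
between the events `A d (b - ε)` and `A d (b + ε)`, whose probabilities converge to values of a
function continuous at `b`. The events `E d` need not be measurable. -/
lemma tendsto_measureReal_of_sandwich {Ω ι : Type*} [MeasurableSpace Ω] {P : Measure Ω}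
    [IsProbabilityMeasure P] {l : Filter ι} {E : ι → Set Ω} {A : ι → ℝ → Set Ω} {H : ℝ → ℝ}
    {b : ℝ} (hb : 0 < b) (hH : ContinuousAt H b)
    (hA : ∀ c, 0 ≤ c → Tendsto (fun d => P.real (A d c)) l (𝓝 (H c)))
    (hE : ∀ ε : ℝ, 0 < ε → ∀ η : ℝ, 0 < η → ∀ᶠ d in l, ∃ B : Set Ω, P.real B ≤ η ∧
      E d ⊆ A d (b + ε) ∪ B ∧ A d (b - ε) ⊆ E d ∪ B) :
    Tendsto (fun d => P.real (E d)) l (𝓝 (H b)) := by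
  rw [Metric.tendsto_nhds]
  intro ρ hρ
  obtain ⟨γ, hγ, hγH⟩ := Metric.continuousAt_iff.1 hH (ρ / 3) (by positivity)
  set ε := min (γ / 2) b with hεd
  have hε : 0 < ε := by positivity
  have hεγ : ε < γ := (min_le_left _ _).trans_lt (by linarith)
  have hεb : ε ≤ b := min_le_right _ _
  have h1 : dist (H (b + ε)) (H b) < ρ / 3 := hγH (by simpa [Real.dist_eq, abs_of_pos hε])
  have h2 : dist (H (b - ε)) (H b) < ρ / 3 := hγH (by simpa [Real.dist_eq, abs_of_pos hε])
  filter_upwards [hE ε hε (ρ / 4) (by positivity),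
    Metric.tendsto_nhds.1 (hA (b + ε) (by linarith)) (ρ / 3) (by positivity),
    Metric.tendsto_nhds.1 (hA (b - ε) (by linarith)) (ρ / 3) (by positivity)]
    with d ⟨B, hB, hle, hge⟩ h3 h4
  have h5 := (measureReal_mono (μ := P) hle).trans (measureReal_union_le _ _)
  have h6 := (measureReal_mono (μ := P) hge).trans (measureReal_union_le _ _)
  rw [Real.dist_eq, abs_lt] at *
  constructor <;> linarith [h1.1, h1.2, h2.1, h2.2, h3.1, h3.2, h4.1, h4.2]

/-- The deterministic sample size `⌈(z / d)² ξ²⌉` around which the stopping time concentrates. -/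
noncomputable def refSize (F : Measure ℝ) (α d : ℝ) : ℕ :=
  ⌈(upperQuantile (α / 2) / d) ^ 2 * asympVar F⌉₊

lemma tendsto_upperQuantile_div {α : ℝ} (hz : 0 < upperQuantile (α / 2)) :
    Tendsto (fun d : ℝ => upperQuantile (α / 2) / d) (𝓝[>] 0) atTop :=
  tendsto_inv_nhdsGT_zero.const_mul_atTop hz

lemma tendsto_refSize {F : Measure ℝ} {α : ℝ} (hz : 0 < upperQuantile (α / 2))
    (hv : 0 < asympVar F) :
    Tendsto (refSize F α) (𝓝[>] 0) atTop :=
  tendsto_nat_ceil_atTop.comp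
    (((tendsto_pow_atTop two_ne_zero).comp (tendsto_upperQuantile_div hz)).atTop_mul_const hv)

lemma tendsto_sqrt_refSize_div {F : Measure ℝ} {α : ℝ}
    (hz : 0 < upperQuantile (α / 2)) (hv : 0 < asympVar F) :
    Tendsto (fun d => √(refSize F α d) / (upperQuantile (α / 2) / d)) (𝓝[>] 0)
      (𝓝 √(asympVar F)) := by
  have hr := (tendsto_pow_atTop two_ne_zero).comp (tendsto_upperQuantile_div hz)
  have h := (tendsto_nat_ceil_mul_div_atTop hv.le).comp hr
  refine (h.sqrt).congr' ?_
  filter_upwards [self_mem_nhdsWithin] with d hd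
  have hr0 : 0 < upperQuantile (α / 2) / d := div_pos hz hd
  simp only [Function.comp_apply, refSize]
  rw [Real.sqrt_div (Nat.cast_nonneg _), Real.sqrt_sq hr0.le, mul_comm]

/-- The threshold of the standardised statistic tends to `z`, and the stopping time enters the
Anscombe window, when `a` (sample mean over mean), `w` (normalised stopping time) and `κ`
(normalised root of the reference size) are close to their limits `1`, `v` and `√v`. -/
lemma exists_tolerance {v z : ℝ} (hv : 0 < v) {ε δ : ℝ} (hε : 0 < ε) (hδ : 0 < δ) :
    ∃ γ : ℝ, 0 < γ ∧ γ < 1 ∧ ∀ a w κ : ℝ, |a - 1| ≤ γ → |w - v| ≤ 2 * γ → |κ - √v| ≤ γ →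
      |a * (z * w / (√v * κ)) - z| < ε ∧ |w - κ ^ 2| < δ * κ ^ 2 := by
  have hs : 0 < √v := Real.sqrt_pos.2 hv
  have hc1 : ContinuousAt (fun p : ℝ × ℝ × ℝ => |p.1 * (z * p.2.1 / (√v * p.2.2)) - z|)
      (1, v, √v) := by
    refine ContinuousAt.abs (ContinuousAt.sub (continuousAt_fst.mul ?_) continuousAt_const)
    refine ContinuousAt.div (by fun_prop) (by fun_prop) ?_
    simp only
    positivity
  have hc2 : ContinuousAt (fun p : ℝ × ℝ × ℝ => |p.2.1 - p.2.2 ^ 2| - δ * p.2.2 ^ 2)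
      (1, v, √v) := by fun_prop
  have h1 : |(1 : ℝ) * (z * v / (√v * √v)) - z| < ε := by
    rw [Real.mul_self_sqrt hv.le, mul_div_cancel_right₀ _ hv.ne']
    simpa
  have h2 : |v - √v ^ 2| - δ * √v ^ 2 < 0 := by
    rw [Real.sq_sqrt hv.le]
    simp [hδ, hv]
  obtain ⟨γ, hγ, h⟩ := Metric.eventually_nhds_iff.1
    ((hc1.eventually_lt_const h1).and (hc2.eventually_lt_const h2))
  refine ⟨min (γ / 4) (1 / 2), by positivity, (min_le_right _ _).trans_lt (by norm_num),
    fun a w κ ha hw hκ => ?_⟩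
  have hm : min (γ / 4) (1 / 2) ≤ γ / 4 := min_le_left _ _
  have := h (y := (a, w, κ)) (by
    rw [Prod.dist_eq, Prod.dist_eq, Real.dist_eq, Real.dist_eq, Real.dist_eq]
    refine max_lt (by linarith) (max_lt (by linarith) (by linarith)))
  exact ⟨this.1, by linarith [this.2]⟩

section Coverage

variable {Ω : Type*} [MeasurableSpace Ω] {P : Measure Ω} [IsProbabilityMeasure P]
  {F : Measure ℝ} [IsProbabilityMeasure F] {X : ℕ → Ω → ℝ}

/-- Up to an event of small probability, coverage at the stopping time is sandwiched between
events about the standardised sum at the deterministic index `refSize F α d`. -/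
theorem eventually_coverage_sandwich (hmeas : ∀ i, Measurable (X i)) (hindep : iIndepFun X P)
    (hlaw : ∀ i, P.map (X i) = F) (hnonneg : ∀ᵐ x ∂F, 0 ≤ x) (hF : MemLp (fun x : ℝ => x) 2 F)
    (hμ : 0 < popMean F) (hv : 0 < asympVar F) {α : ℝ} (hz : 0 < upperQuantile (α / 2))
    {ε : ℝ} (hε : 0 < ε) {η : ℝ} (hη : 0 < η) :
    ∀ᶠ d in 𝓝[>] (0 : ℝ), ∃ B : Set Ω, P.real B ≤ η ∧
      {ω | stopTime α d (fun i => X i ω) < ⊤ ∧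
        sampleGini (fun i => X i ω) (stopTime α d (fun i => X i ω)).toNat - d < giniIndex F ∧
        giniIndex F < sampleGini (fun i => X i ω) (stopTime α d (fun i => X i ω)).toNat + d}
        ⊆ {ω | |∑ i ∈ Finset.range (refSize F α d),
            linKernel F (X i ω) / (2 * popMean F ^ 2 * √(asympVar F))|
            ≤ (upperQuantile (α / 2) + ε) * √(refSize F α d)} ∪ B ∧
      {ω | |∑ i ∈ Finset.range (refSize F α d),
            linKernel F (X i ω) / (2 * popMean F ^ 2 * √(asympVar F))|
            ≤ (upperQuantile (α / 2) - ε) * √(refSize F α d)}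
        ⊆ {ω | stopTime α d (fun i => X i ω) < ⊤ ∧
        sampleGini (fun i => X i ω) (stopTime α d (fun i => X i ω)).toNat - d < giniIndex F ∧
        giniIndex F < sampleGini (fun i => X i ω) (stopTime α d (fun i => X i ω)).toNat + d} ∪ B
    := by
  set z := upperQuantile (α / 2) with hzd
  set v := asympVar F with hvd
  set μ := popMean F with hμd
  set s := 2 * μ ^ 2 * √v with hs
  have hξ : 0 < √v := Real.sqrt_pos.2 hv
  have hs0 : 0 < s := by positivity
  have hF1 := hF.integrable (by norm_num)
  have hε1 : 0 < ε / 4 := by positivity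
  have hη3 : 0 < η / 3 := by positivity
  obtain ⟨δ, hδ0, hδ1, hY⟩ := exists_window_sum hmeas hindep hlaw
    (ψ := fun x => linKernel F x / s) ((continuous_linKernel hF1).measurable.div_const s)
    (by simpa only [div_eq_mul_inv] using (memLp_linKernel hF).mul_const s⁻¹)
    (by rw [integral_div, integral_linKernel hF, zero_div]) hε1 hη3
  have hR := eventually_window_meanDiffRem hmeas hindep hlaw hF
    (ε := s / μ * (ε / 4)) (by positivity) hη3
  obtain ⟨γ, hγ0, hγ1, hγ⟩ := exists_tolerance (z := z) hv hε1 hδ0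
  -- the regular behaviour of the estimators from some index on
  obtain ⟨K, hK⟩ := exists_measureReal_not_forall_le (P := P)
    (p := fun n ω => |varEst (fun i => X i ω) n - v| ≤ γ ∧
      |sampleMean (fun i => X i ω) n / μ - 1| ≤ γ)
    (fun n => by
      have hX : Measurable fun ω i => X i ω := measurable_pi_lambda _ hmeas
      have h1 := (measurable_varEst n).comp hX
      have h2 := (measurable_sampleMean n).comp hX
      exact (measurableSet_le (h1.sub_const v).abs measurable_const).inter
        (measurableSet_le ((h2.div_const μ).sub_const 1).abs measurable_const))
    (by
      filter_upwards [ae_isTypical hmeas hindep hlaw hnonneg hF] with ω hω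
      have h1 := (hω.tendsto_varEst hF hμ).sub_const v
      have h2 := (hω.mean.div_const μ).sub_const 1
      rw [sub_self] at h1
      rw [← hμd, div_self hμ.ne', sub_self] at h2
      exact (h1.abs.eventually_le_const (by simpa using hγ0)).and
        (h2.abs.eventually_le_const (by simpa using hγ0))) hη3
  have hpos : ∀ m : ℝ, |m / μ - 1| ≤ γ → 0 < m := fun m hm => by
    have : 0 < m / μ := by linarith [(abs_le.1 hm).1]
    exact (div_pos_iff_of_pos_right hμ).1 this
  have hκ : ∀ᶠ d in 𝓝[>] (0 : ℝ), |√(refSize F α d) / (z / d) - √v| ≤ γ := by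
    have h := (tendsto_sqrt_refSize_div hz hv).sub_const √v
    rw [← hvd, sub_self] at h
    exact h.abs.eventually_le_const (by simpa using hγ0)
  filter_upwards [eventually_stopTime_close hz hv hγ0 (K + 1), hκ,
    (tendsto_refSize hz hv).eventually hR, (tendsto_refSize hz hv).eventually_gt_atTop 0,
    self_mem_nhdsWithin] with d hclose hκd hRd hm0 hd
  set m := refSize F α d with hm
  have hd0 : 0 < d := hd
  have hr0 : 0 < z / d := div_pos hz hd0
  have hm' : (0 : ℝ) < m := by exact_mod_cast hm0
  have hsm : 0 < √(m : ℝ) := Real.sqrt_pos.2 hm'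
  set B1 := {ω | ∃ n : ℕ, |(n : ℝ) - m| ≤ δ * m ∧ ε / 4 * √m <
    |∑ i ∈ Finset.range n, linKernel F (X i ω) / s
      - ∑ i ∈ Finset.range m, linKernel F (X i ω) / s|} with hB1
  set B2 := {ω | ∃ n : ℕ, |(n : ℝ) - m| ≤ m / 2 ∧
    s / μ * (ε / 4) * √m < |meanDiffRem F (fun i => X i ω) n|} with hB2
  set B3 := {ω | ¬ ∀ n, K ≤ n → |varEst (fun i => X i ω) n - v| ≤ γ ∧
    |sampleMean (fun i => X i ω) n / μ - 1| ≤ γ} with hB3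
  have key : ∀ ω, ω ∉ B1 ∪ B2 ∪ B3 → ∃ N : ℕ, stopTime α d (fun i => X i ω) = N ∧
      ∃ q t : ℝ, |q - ∑ i ∈ Finset.range m, linKernel F (X i ω) / s| ≤ ε / 2 * √m ∧
        |t - z * √m| < ε / 4 * √m ∧
        ((sampleGini (fun i => X i ω) N - d < giniIndex F ∧
          giniIndex F < sampleGini (fun i => X i ω) N + d) ↔ |q| < t) := by
    intro ω hω
    simp only [hB1, hB2, hB3, Set.mem_union, Set.mem_ofPred_eq, not_or, not_exists, not_and,
      not_lt, not_not] at hω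
    obtain ⟨⟨hω1, hω2⟩, hω3⟩ := hω
    obtain ⟨N, hN, hKN, hNv⟩ := hclose (fun i => X i ω) fun n hn =>
      ⟨(hω3 n (by omega)).1, (hpos _ (hω3 n (by omega)).2).ne'⟩
    have hmean := (hω3 N (by omega)).2
    have hmpos := hpos _ hmean
    obtain ⟨h1, h2⟩ := hγ _ _ _ hmean hNv hκd
    rw [← hzd] at h1 h2
    have hwin : |(N : ℝ) - m| ≤ δ * m := by
      have hm2 : (√m / (z / d)) ^ 2 = m / (z / d) ^ 2 := by
        rw [div_pow, Real.sq_sqrt hm'.le]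
      rw [hm2, ← sub_div, abs_div, abs_of_pos (show 0 < (z / d) ^ 2 by positivity),
        ← mul_div_assoc] at h2
      exact ((div_lt_div_iff_of_pos_right (by positivity)).1 h2).le
    refine ⟨N, hN, _, _, ?_, ?_, abs_sampleGini_sub_lt_iff hμ hξ (by omega) hmpos⟩
    · have h3 := hω1 N hwin
      have h4 := hω2 N (hwin.trans (by nlinarith))
      have h5 : |μ / s * meanDiffRem F (fun i => X i ω) N| ≤ ε / 4 * √m := by
        rw [abs_mul, abs_of_pos (div_pos hμ hs0)]
        calc μ / s * |meanDiffRem F (fun i => X i ω) N|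
            ≤ μ / s * (s / μ * (ε / 4) * √m) := by gcongr
          _ = ε / 4 * √m := by field_simp
      rw [← hs, add_sub_right_comm]
      refine (abs_add_le _ _).trans ?_
      linarith
    · have h6 : sampleMean (fun i => X i ω) N / μ * (d * N / √v) - z * √m
          = (sampleMean (fun i => X i ω) N / μ *
            (z * (N / (z / d) ^ 2) / (√v * (√m / (z / d)))) - z) * √m := by
        have hz0 : z ≠ 0 := hz.ne'
        rw [sub_mul]
        congr 1
        field_simp
      rw [h6, abs_mul, abs_of_pos hsm]
      exact mul_lt_mul_of_pos_right h1 hsm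
  refine ⟨B1 ∪ B2 ∪ B3, ?_, ?_, ?_⟩
  · have h1 : P.real B1 ≤ η / 3 := hY m hm0
    have h2 : P.real B2 ≤ η / 3 := hRd
    have h3 : P.real B3 ≤ η / 3 := hK
    have h4 := measureReal_union_le (μ := P) (B1 ∪ B2) B3
    have h5 := measureReal_union_le (μ := P) B1 B2
    linarith
  · intro ω hω
    by_cases hB : ω ∈ B1 ∪ B2 ∪ B3
    · exact Or.inr hB
    left
    obtain ⟨N, hN, q, t, hq, ht, hiff⟩ := key ω hB
    obtain ⟨-, hω⟩ := hω
    rw [hN, ENat.toNat_natCast, hiff] at hω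
    have h1 := abs_sub_abs_le_abs_sub (∑ i ∈ Finset.range m, linKernel F (X i ω) / s) q
    rw [abs_sub_comm] at h1
    have h2 : 0 < ε / 4 * √m := by positivity
    simp only [Set.mem_ofPred_eq]
    linarith [(abs_lt.1 ht).2]
  · intro ω hω
    by_cases hB : ω ∈ B1 ∪ B2 ∪ B3
    · exact Or.inr hB
    left
    obtain ⟨N, hN, q, t, hq, ht, hiff⟩ := key ω hB
    simp only [Set.mem_ofPred_eq] at hω ⊢
    rw [hN, ENat.toNat_natCast, hiff]
    refine ⟨ENat.natCast_lt_top N, ?_⟩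
    have h1 := abs_sub_abs_le_abs_sub q (∑ i ∈ Finset.range m, linKernel F (X i ω) / s)
    have h2 : 0 < ε / 4 * √m := by positivity
    linarith [(abs_lt.1 ht).1]

/-- The central limit theorem for the standardised influence function, along the deterministic
sample sizes. -/
lemma tendsto_measureReal_refSize (hmeas : ∀ i, Measurable (X i)) (hindep : iIndepFun X P)
    (hlaw : ∀ i, P.map (X i) = F) (hF : MemLp (fun x : ℝ => x) 2 F) (hμ : 0 < popMean F)
    (hv : 0 < asympVar F) {α : ℝ} (hz : 0 < upperQuantile (α / 2)) {c : ℝ} (hc : 0 ≤ c) :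
    Tendsto (fun d => P.real {ω | |∑ i ∈ Finset.range (refSize F α d),
        linKernel F (X i ω) / (2 * popMean F ^ 2 * √(asympVar F))| ≤ c * √(refSize F α d)})
      (𝓝[>] 0) (𝓝 (2 * cdf (gaussianReal 0 1) c - 1)) := by
  have hF1 := hF.integrable (by norm_num)
  set s := 2 * popMean F ^ 2 * √(asympVar F) with hs
  have hψ : Measurable fun x => linKernel F x / s :=
    (continuous_linKernel hF1).measurable.div_const s
  refine (tendsto_measureReal_abs_sum_le (P := P) (Y := fun i ω => linKernel F (X i ω) / s)
    (hindep.comp (fun _ x => linKernel F x / s) fun _ => hψ) (fun i => ?_) ?_ ?_ hc).comp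
    (tendsto_refSize hz hv)
  · exact IdentDistrib.comp ⟨(hmeas i).aemeasurable, (hmeas 0).aemeasurable, by rw [hlaw, hlaw]⟩ hψ
  · rw [integral_comp_law hmeas hlaw hψ, integral_div, integral_linKernel hF, zero_div]
  · simp only [Pi.pow_apply]
    rw [integral_comp_law hmeas hlaw (hψ.pow_const 2)]
    simp only [div_pow]
    rw [integral_div, integral_linKernel_sq hF hμ, hs, mul_pow, Real.sq_sqrt hv.le]
    field_simp
    norm_num

end Coverage

lemma memLp_two_of_integrable_pow_four {F : Measure ℝ} [IsFiniteMeasure F]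
    (h : Integrable (fun x : ℝ => x ^ 4) F) : MemLp (fun x : ℝ => x) 2 F := by
  rw [memLp_two_iff_integrable_sq (f := fun x : ℝ => x) measurable_id.aestronglyMeasurable]
  refine Integrable.mono' ((integrable_const (1 : ℝ)).add h)
    (measurable_id.pow_const 2).aestronglyMeasurable (ae_of_all _ fun x => ?_)
  rw [Real.norm_eq_abs, abs_of_nonneg (sq_nonneg x)]
  simp only [Pi.add_apply]
  nlinarith [sq_nonneg (x ^ 2 - 1)]

end GiniSeq

theorem theorem2 {Ω : Type*} [MeasurableSpace Ω] (P : Measure Ω) [IsProbabilityMeasure P]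
    (F : Measure ℝ) [IsProbabilityMeasure F] (X : ℕ → Ω → ℝ)
    (hmeas : ∀ i, Measurable (X i)) (hindep : iIndepFun X P)
    (hlaw : ∀ i, P.map (X i) = F)
    (hnonneg : ∀ᵐ x ∂F, 0 ≤ x)
    (hmoment : Integrable (fun x : ℝ => x ^ 4) F)
    (hmean : 0 < GiniSeq.popMean F)
    (hvar : 0 < GiniSeq.asympVar F)
    (α : ℝ) (hα0 : 0 < α) (hα1 : α < 1) :
    (∀ d : ℝ, 0 < d → ∀ᵐ ω ∂P, GiniSeq.stopTime α d (fun i => X i ω) < ⊤) ∧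
    Tendsto
      (fun d : ℝ => P.real {ω | GiniSeq.stopTime α d (fun i => X i ω) < ⊤ ∧
        GiniSeq.sampleGini (fun i => X i ω)
            (GiniSeq.stopTime α d (fun i => X i ω)).toNat - d < GiniSeq.giniIndex F ∧
        GiniSeq.giniIndex F < GiniSeq.sampleGini (fun i => X i ω)
            (GiniSeq.stopTime α d (fun i => X i ω)).toNat + d})
      (𝓝[>] (0 : ℝ)) (𝓝 (1 - α)) := by
  have hF := GiniSeq.memLp_two_of_integrable_pow_four hmoment
  have hz : 0 < GiniSeq.upperQuantile (α / 2) :=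
    GiniSeq.upperQuantile_pos (by linarith) (by linarith)
  refine ⟨fun d _ => ?_, ?_⟩
  · filter_upwards [GiniSeq.ae_isTypical hmeas hindep hlaw hnonneg hF] with ω hω
    have hne : (GiniSeq.stopSet α d fun i => X i ω).Nonempty :=
      GiniSeq.stopSet_nonempty α d (C := GiniSeq.asympVar F + 1)
        (((hω.tendsto_varEst hF hmean).eventually_le_const (by linarith)).and
          (hω.mean.eventually_ne hmean.ne'))
    rw [GiniSeq.stopTime_eq_sInf hne]
    exact ENat.natCast_lt_top _
  · have hcov : 2 * cdf (gaussianReal 0 1) (GiniSeq.upperQuantile (α / 2)) - 1 = 1 - α := by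
      rw [GiniSeq.cdf_upperQuantile (by linarith) (by linarith)]
      ring
    rw [← hcov]
    refine GiniSeq.tendsto_measureReal_of_sandwich
      (H := fun c => 2 * cdf (gaussianReal 0 1) c - 1) hz
      (by have := GiniSeq.continuous_cdf_gaussianReal; fun_prop)
      (fun c hc => GiniSeq.tendsto_measureReal_refSize hmeas hindep hlaw hF hmean hvar hz hc)
      fun ε hε η hη => GiniSeq.eventually_coverage_sandwich hmeas hindep hlaw hnonneg hF hmean
        hvar hz hε hη
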